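/- Let $n\geqslant 4$ and let $S_n$ be the star graph with vertex set $\{0,1,\ldots,n-1\}$ and edges $\{0,i\}$, $1\leqslant i\leqslant n-1$. Let $\mathcal{DPS}_n$ be the monoid of all partial isometries of $S_n$, i.e. of all partial transformations $\alpha$ of $\{0,1,\ldots,n-1\}$ such that $\mathrm{d}(x\alpha,y\alpha)=\mathrm{d}(x,y)$ for all $x,y\in\mathrm{Dom}(\alpha)$, where $\mathrm{d}$ is the geodesic distance of $S_n$; transformations are written on the right and composed from left to right. Consider the partial transformations $$ \alpha_1=\begin{pmatrix}0&1&2&\cdots&n-2&n-1\\0&2&3&\cdots&n-1&1\end{pmatrix},\quad \alpha_2=\begin{pmatrix}0&1&2&3&\cdots&n-1\\0&2&1&3&\cdots&n-1\end{pmatrix},\quad \beta_1=\begin{pmatrix}0&1&\cdots&n-2\\0&1&\cdots&n-2\end{pmatrix}, $$ $$ \beta_2=\begin{pmatrix}1&2&\cdots&n-1\\1&2&\cdots&n-1\end{pmatrix},\quad \gamma=\begin{pmatrix}0&1\\1&0\end{pmatrix}. $$ Let $A=\{a_1,a_2,b_1,b_2,c\}$ be an alphabet with $5$ letters and let $R\subseteq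 A^*\times A^*$ be the set of the following monoid relations: * $(R_1)$ $a_2^2=1$; * $(R_2)$ $a_1^{n-1}=1$; * $(R_3)$ $(a_1a_2)^{n-2}=1$; * $(R_4)$ $(a_2a_1^{n-2}a_2a_1)^3=1$; * $(R_5)$ $(a_2a_1^{n-1-j}a_2a_1^j)^2=1$, for $2\leqslant j\leqslant n-3$; * $(R_6)$ $b_1^2=b_1$ and $b_2^2=b_2$; * $(R_7)$ $a_2b_1=b_1a_2$, $b_2a_2=a_2b_2$, $b_2a_1=a_1b_2$ and $b_2b_1=b_1b_2$; * $(R_8)$ $a_1a_2a_1^{n-2}b_1a_1a_2a_1^{n-2}=a_1^{n-2}b_1a_1$; * $(R_9)$ $(a_1^{n-2}b_1a_1a_2)^2=(a_2a_1^{n-2}b_1a_1)^2$; * $(R_{10})$ $a_1^{n-2}b_1a_1a_2a_1^{n-2}b_1a_1=(a_2a_1^{n-2}b_1a_1)^2$; * $(R_{11})$ $c^3=c$; * $(R_{12})$ $ca_1=ca_2$; * $(R_{13})$ $a_1^{n-2}c=a_2c$; * $(R_{14})$ $a_2a_1^jc=a_1^jc$, for $1\leqslant j\leqslant n-3$; *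 $(R_{15})$ $b_1a_1c=cb_2$; * $(R_{16})$ $b_1a_1^jc=a_1^jc$, for $2\leqslant j\leqslant n-3$; * $(R_{17})$ $(b_1a_1)^{n-3}b_1=c^2a_2a_1^{n-4}$; * $(R_{18})$ $b_2c^2=ca_2c$; * $(R_{19})$ $(b_2c)^2=b_2cb_2$. Then $R$ consists of exactly $3n+9$ relations; $\alpha_1,\alpha_2,\beta_1,\beta_2,\gamma$ are pairwise distinct elements of $\mathcal{DPS}_n$ that generate the monoid $\mathcal{DPS}_n$; and $\mathcal{DPS}_n$ is defined by the presentation $\langle A\mid R\rangle$, associated to these generators: with $\rho_R$ the smallest congruence on $A^*$ containing $R$, there is an isomorphism of monoids $A^*/\rho_R\to\mathcal{DPS}_n$ that maps the classes of $a_1,a_2,b_1,b_2,c$ to $\alpha_1,\alpha_2,\beta_1,\beta_2,\gamma$, respectively. -/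

import Mathlib

/-- Partial transformations of `V`: the value `none` at `x` means that `x` is outside the domain. -/
@[ext]
structure PartialTransf (V : Type*) where
  toFun : V → Option V

namespace PartialTransf

instance {V : Type*} : CoeFun (PartialTransf V) (fun _ => V → Option V) := ⟨toFun⟩

/-- Maps act on the right: `f * g` is first `f`, then `g`. -/
instance {V : Type*} : Monoid (PartialTransf V) where
  mul f g := ⟨fun x => (f x).bind g⟩
  one := ⟨some⟩
  mul_assoc f g h := PartialTransf.ext (funext fun x => Option.bind_assoc (f x) g h)
  one_mul _ := rfl
  mul_one f := PartialTransf.ext (funext fun x => Option.bind_fun_some (f x))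

theorem one_apply {V : Type*} (x : V) : (1 : PartialTransf V) x = some x := rfl

theorem mul_apply {V : Type*} (f g : PartialTransf V) (x : V) : (f * g) x = (f x).bind g := rfl

end PartialTransf

/-- The monoid of partial isometries of `G`: the partial transformations that preserve the geodesic
distance between any two points of their domain. -/
def partialIsometries {V : Type*} (G : SimpleGraph V) : Submonoid (PartialTransf V) where
  carrier := {f | ∀ x y x' y' : V, f x = some x' → f y = some y' → G.dist x' y' = G.dist x y}
  one_mem' := by
    intro x y x' y' hx hy
    rw [PartialTransf.one_apply, Option.some.injEq] at hx hy
    rw [hx, hy]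
  mul_mem' := by
    intro f g hf hg x y x' y' hx hy
    rw [PartialTransf.mul_apply, Option.bind_eq_some_iff] at hx hy
    obtain ⟨u, hxu, hu⟩ := hx
    obtain ⟨v, hyv, hv⟩ := hy
    exact (hg u v x' y' hu hv).trans (hf x y u v hxu hyv)

/-- The monoid `DPS_n` of partial isometries of the star graph on `{0, …, n - 1}` with centre `0`. -/
def DPS (n : ℕ) [NeZero n] : Submonoid (PartialTransf (Fin n)) :=
  partialIsometries (SimpleGraph.starGraph (0 : Fin n))

namespace DPS

/-- The alphabet of the presentation. -/
inductive Letter : Type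
  | a₁ | a₂ | b₁ | b₂ | c

/-- The five transformations `α₁, α₂, β₁, β₂, γ` that the letters stand for:
`α₁` fixes `0` and is the cycle `1 ↦ 2 ↦ ⋯ ↦ n - 1 ↦ 1`, `α₂` transposes `1` and `2`,
`β₁` and `β₂` are the partial identities undefined exactly at `n - 1` and at `0`, and
`γ`, with domain `{0, 1}`, exchanges `0` and `1`. -/
def gen (n : ℕ) [NeZero n] : Letter → PartialTransf (Fin n)
  | .a₁ => ⟨fun i =>
      if i = 0 then some 0 else if h : (i : ℕ) + 1 < n then some ⟨(i : ℕ) + 1, h⟩ else some 1⟩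
  | .a₂ => ⟨fun i => some (Equiv.swap 1 2 i)⟩
  | .b₁ => ⟨fun i => if (i : ℕ) + 1 < n then some i else none⟩
  | .b₂ => ⟨fun i => if i = 0 then none else some i⟩
  | .c => ⟨fun i => if i = 0 then some 1 else if i = 1 then some 0 else none⟩

/-- The letters as words. -/
abbrev a₁ : FreeMonoid Letter := .of .a₁
abbrev a₂ : FreeMonoid Letter := .of .a₂
abbrev b₁ : FreeMonoid Letter := .of .b₁
abbrev b₂ : FreeMonoid Letter := .of .b₂
abbrev c : FreeMonoid Letter := .of .c

/-- The set of defining relations `u = v`, as pairs of words `(u, v)`; meant for `n ≥ 4`, where no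
subtraction below truncates. -/
def relations (n : ℕ) : Set (FreeMonoid Letter × FreeMonoid Letter) :=
  { (a₂ ^ 2, 1),
    (a₁ ^ (n - 1), 1),
    ((a₁ * a₂) ^ (n - 2), 1),
    ((a₂ * a₁ ^ (n - 2) * a₂ * a₁) ^ 3, 1) } ∪
  (fun j => ((a₂ * a₁ ^ (n - 1 - j) * a₂ * a₁ ^ j) ^ 2, 1)) '' Set.Icc 2 (n - 3) ∪
  { (b₁ ^ 2, b₁),
    (b₂ ^ 2, b₂),
    (a₂ * b₁, b₁ * a₂),
    (b₂ * a₂, a₂ * b₂),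
    (b₂ * a₁, a₁ * b₂),
    (b₂ * b₁, b₁ * b₂),
    (a₁ * a₂ * a₁ ^ (n - 2) * b₁ * a₁ * a₂ * a₁ ^ (n - 2), a₁ ^ (n - 2) * b₁ * a₁),
    ((a₁ ^ (n - 2) * b₁ * a₁ * a₂) ^ 2, (a₂ * a₁ ^ (n - 2) * b₁ * a₁) ^ 2),
    (a₁ ^ (n - 2) * b₁ * a₁ * a₂ * a₁ ^ (n - 2) * b₁ * a₁, (a₂ * a₁ ^ (n - 2) * b₁ * a₁) ^ 2),
    (c ^ 3, c),
    (c * a₁, c * a₂),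
    (a₁ ^ (n - 2) * c, a₂ * c) } ∪
  (fun j => (a₂ * a₁ ^ j * c, a₁ ^ j * c)) '' Set.Icc 1 (n - 3) ∪
  { (b₁ * a₁ * c, c * b₂) } ∪
  (fun j => (b₁ * a₁ ^ j * c, a₁ ^ j * c)) '' Set.Icc 2 (n - 3) ∪
  { ((b₁ * a₁) ^ (n - 3) * b₁, c ^ 2 * a₂ * a₁ ^ (n - 4)),
    (b₂ * c ^ 2, c * a₂ * c),
    ((b₂ * c) ^ 2, b₂ * c * b₂) }

/-- The monoid defined by the presentation `⟨a₁, a₂, b₁, b₂, c ∣ relations n⟩`. -/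
abbrev Presented (n : ℕ) : Type :=
  PresentedMonoid fun u v : FreeMonoid Letter => (u, v) ∈ relations n

/-- The class of a letter in the presented monoid. -/
abbrev letterClass (n : ℕ) (x : Letter) : Presented n :=
  PresentedMonoid.of (fun u v : FreeMonoid Letter => (u, v) ∈ relations n) x

end DPS

/-! Distances in a star are 0, 1 or 2, and distinct leaves are at distance 2. Hence a partial
isometry is of one of five kinds: it fixes the centre, or omits it, and is a partial injection of
the leaves; or it sends the centre to a leaf and one leaf to the centre, and nothing else; or it
does only one of these two things (`exists_evalShape_eq`).

The presentation is established by normal forms. Put n = N + 2, with leaves `Fin (N + 1)`. In any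
monoid where the relations hold, the letters a₁ and a₂ give a copy of the symmetric group on the
leaves, by Moore's presentation (`exists_hom_perm_of_moore`); this rests on the Coxeter presentation
of type A, which follows from a coset count (`card_closure_le_factorial`). Conjugates of b₁ and
their products are the idempotents that delete sets of leaves (`exists_idempotents`). The relations
on b₂ and c supply the remaining axioms of `StarData` (`exists_starData_of_relations`).

From these axioms alone, the products `StarData.nf`, one family for each kind, are closed under
right multiplication by the generators, so they fill the presented monoid; and `nf p` depends only
on the partial transformation `evalShape p` (`nf_eq_of_evalShape_eq`). Conversely the actual
transformations satisfy the relations (`StarData.Compatible.satisfies`), which gives a homomorphism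
that takes `nf p` to `evalShape p`. It is therefore injective, and its image is the set of all
partial isometries.

The relations are counted through the numbers of occurrences of letters, except for one family that
needs a finer invariant (`injOn_moore`). -/

section TypeA

/-! ### The Coxeter presentation of the symmetric group -/

theorem prod_range_mul_of_lt {G : Type*} [Group G] {n : ℕ} {s : ℕ → G}
    (comm : ∀ i j, i + 1 < j → j < n → s i * s j = s j * s i) {m i : ℕ} (hm : m < i) (hi : i < n) :
    ((List.range m).map s).prod * s i = s i * ((List.range m).map s).prod := by
  induction m with
  | zero => simp
  | succ m ih =>
    rw [List.range_succ, List.map_append, List.prod_append, List.map_singleton,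
      List.prod_singleton, mul_assoc, comm m i hm hi, ← mul_assoc, ih (by omega), mul_assoc]

/-- The product s₀ ⋯ sₘ₋₁ behaves like a cycle that shifts indices by one: the braid relation
settles m = i + 2, and later factors commute with sᵢ. -/
theorem prod_range_mul_of_gt {G : Type*} [Group G] {n : ℕ} {s : ℕ → G}
    (comm : ∀ i j, i + 1 < j → j < n → s i * s j = s j * s i)
    (braid : ∀ i, i + 1 < n → s i * s (i + 1) * s i = s (i + 1) * s i * s (i + 1))
    {m i : ℕ} (hm : i + 2 ≤ m) (hmn : m ≤ n) :
    ((List.range m).map s).prod * s i = s (i + 1) * ((List.range m).map s).prod := by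
  induction m, hm using Nat.le_induction with
  | base =>
    have h := prod_range_mul_of_lt comm (Nat.lt_succ_self i) (by omega)
    have hb := braid i (by omega)
    simp only [List.range_succ, List.map_append, List.prod_append, List.map_singleton,
      List.prod_singleton, mul_assoc] at h hb ⊢
    rw [hb, ← mul_assoc, h, mul_assoc]
  | succ m hm ih =>
    rw [List.range_succ, List.map_append, List.prod_append, List.map_singleton,
      List.prod_singleton, mul_assoc, ← comm i m (by omega) (by omega), ← mul_assoc,
      ih (by omega), mul_assoc]

/-- A group generated by `n` elements that satisfy the Coxeter relations of type `A` has at most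
`(n + 1)!` elements. -/
theorem card_closure_le_factorial {G : Type*} [Group G] (n : ℕ) (s : ℕ → G)
    (sq : ∀ i < n, s i * s i = 1)
    (comm : ∀ i j, i + 1 < j → j < n → s i * s j = s j * s i)
    (braid : ∀ i, i + 1 < n → s i * s (i + 1) * s i = s (i + 1) * s i * s (i + 1)) :
    (Subgroup.closure (s '' Set.Iio n) : Set G).Finite ∧
      (Subgroup.closure (s '' Set.Iio n) : Set G).ncard ≤ (n + 1).factorial := by
  induction n generalizing s with
  | zero => simp
  | succ n ih =>
    obtain ⟨hfin, hcard⟩ := ih (fun i => s (i + 1)) (fun i hi => sq _ (by omega))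
      (fun i j hij hj => comm _ _ (by omega) (by omega)) (fun i hi => braid _ (by omega))
    set H := Subgroup.closure ((fun i => s (i + 1)) '' Set.Iio n) with hH
    -- The union of the n + 2 right cosets of H (generated by s₁, …, sₙ) with representatives s₀ ⋯
    -- sₘ₋₁ for m ≤ n + 1. It is closed under right multiplication by sᵢ: for m < i or m ≥ i + 2 the
    -- generator passes to the left and is absorbed by H, for m = i the representative grows, and
    -- for m = i + 1 it shrinks.
    let T : Set G := (fun p : G × ℕ => p.1 * ((List.range p.2).map s).prod) ''
      ((H : Set G) ×ˢ (Finset.range (n + 2) : Set ℕ))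
    have hfin' : ((H : Set G) ×ˢ (Finset.range (n + 2) : Set ℕ)).Finite :=
      hfin.prod (Finset.finite_toSet _)
    have mem_H : ∀ i, 0 < i → i < n + 1 → s i ∈ H := fun i h0 hi =>
      Subgroup.subset_closure ⟨i - 1, by simp; omega, by simp only; congr 1; omega⟩
    have hT : (Subgroup.closure (s '' Set.Iio (n + 1)) : Set G) ⊆ T := by
      intro x hx
      have step : ∀ y ∈ T, ∀ i < n + 1, y * s i ∈ T := by
        rintro _ ⟨⟨h, m⟩, ⟨hh, hm⟩, rfl⟩ i hi
        have hm' : m < n + 2 := by simpa using hm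
        rcases lt_trichotomy m i with hmi | hmi | hmi
        · refine ⟨(h * s i, m), ⟨H.mul_mem hh (mem_H i (by omega) hi), hm⟩, ?_⟩
          simp only
          rw [mul_assoc, ← prod_range_mul_of_lt comm hmi hi, mul_assoc]
        · refine ⟨(h, m + 1), ⟨hh, by simp; omega⟩, ?_⟩
          simp [List.range_succ, mul_assoc, hmi]
        · obtain rfl | him : m = i + 1 ∨ i + 2 ≤ m := by omega
          · refine ⟨(h, i), ⟨hh, by simp; omega⟩, ?_⟩
            simp [List.range_succ, mul_assoc, sq i hi]
          · refine ⟨(h * s (i + 1), m), ⟨H.mul_mem hh (mem_H _ (by omega) (by omega)), hm⟩, ?_⟩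
            simp only
            rw [mul_assoc, ← prod_range_mul_of_gt comm braid him (by omega), mul_assoc]
      induction hx using Subgroup.closure_induction_right with
      | one => exact ⟨(1, 0), ⟨H.one_mem, by simp⟩, by simp⟩
      | mul_right y hy z hz hyz =>
        obtain ⟨i, hi, rfl⟩ := hz
        exact step _ hyz i hi
      | mul_inv_cancel y hy z hz hyz =>
        obtain ⟨i, hi, rfl⟩ := hz
        rw [inv_eq_of_mul_eq_one_right (sq i hi)]
        exact step _ hyz i hi
    refine ⟨(hfin'.image _).subset hT, (Set.ncard_le_ncard hT (hfin'.image _)).trans ?_⟩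
    refine (Set.ncard_image_le hfin').trans ?_
    rw [Set.ncard_prod, Set.ncard_coe_finset, Finset.card_range, Nat.factorial_succ (n + 1),
      mul_comm (n + 1 + 1)]
    exact Nat.mul_le_mul_right _ hcard

theorem CoxeterMatrix.isLiftable_A_iff {X : Type*} [Monoid X] {n : ℕ} {s : Fin n → X} :
    (CoxeterMatrix.A n).IsLiftable s ↔
      (∀ i, s i * s i = 1) ∧
      (∀ i j : Fin n, (i : ℕ) + 1 = j → (s i * s j) ^ 3 = 1 ∧ (s j * s i) ^ 3 = 1) ∧
      (∀ i j : Fin n, (i : ℕ) + 1 < j → (s i * s j) ^ 2 = 1 ∧ (s j * s i) ^ 2 = 1) := by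
  constructor
  · intro h
    refine ⟨fun i => by simpa [CoxeterMatrix.A] using h i i, fun i j hij => ?_, fun i j hij => ?_⟩
    · have h1 := h i j
      have h2 := h j i
      have hne : i ≠ j := by rintro rfl; omega
      simp only [CoxeterMatrix.A, Matrix.of_apply, hne, hne.symm, hij, if_false, or_true, true_or,
        if_true] at h1 h2
      exact ⟨h1, h2⟩
    · have h1 := h i j
      have h2 := h j i
      have hne : i ≠ j := by rintro rfl; omega
      have h3 : ¬ ((j : ℕ) + 1 = i ∨ (i : ℕ) + 1 = j) := by omega
      have h4 : ¬ ((i : ℕ) + 1 = j ∨ (j : ℕ) + 1 = i) := by omega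
      simp only [CoxeterMatrix.A, Matrix.of_apply, hne, hne.symm, h3, h4, if_false] at h1 h2
      exact ⟨h1, h2⟩
  · rintro ⟨h1, h2, h3⟩ i j
    simp only [CoxeterMatrix.A, Matrix.of_apply]
    split_ifs with hij hij'
    · rw [hij, h1, one_pow]
    · rcases hij' with h | h
      · exact (h2 _ _ h).2
      · exact (h2 _ _ h).1
    · have : (i : ℕ) ≠ j := fun h => hij (Fin.ext h)
      rcases lt_or_gt_of_ne this with h | h
      · exact (h3 _ _ (by omega)).1
      · exact (h3 _ _ (by omega)).2

theorem isLiftable_swap (n : ℕ) : (CoxeterMatrix.A n).IsLiftable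
    (fun i : Fin n => Equiv.swap i.castSucc i.succ) := by
  rw [CoxeterMatrix.isLiftable_A_iff]
  refine ⟨fun i => Equiv.swap_mul_self _ _, fun i j hij => ?_, fun i j hij => ?_⟩
  · have h : i.succ = j.castSucc := Fin.ext (by simpa using hij)
    have h1 : i.castSucc ≠ j.castSucc := fun h => by simp [Fin.ext_iff] at h; omega
    have h2 : i.castSucc ≠ j.succ := fun h => by simp [Fin.ext_iff] at h; omega
    have h3 : j.castSucc ≠ j.succ := fun h => by simp [Fin.ext_iff] at h
    rw [h]
    constructor <;> ext x <;> simp only [pow_succ, pow_zero, one_mul, Equiv.Perm.mul_apply,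
      Equiv.swap_apply_def, Equiv.Perm.one_apply] <;> grind
  · have h1 : i.castSucc ≠ j.castSucc := fun h => by simp [Fin.ext_iff] at h; omega
    have h2 : i.castSucc ≠ j.succ := fun h => by simp [Fin.ext_iff] at h; omega
    have h3 : i.succ ≠ j.castSucc := fun h => by simp [Fin.ext_iff] at h; omega
    have h4 : i.succ ≠ j.succ := fun h => by simp [Fin.ext_iff] at h; omega
    constructor <;> ext x <;> simp only [pow_succ, pow_zero, one_mul, Equiv.Perm.mul_apply,
      Equiv.swap_apply_def, Equiv.Perm.one_apply] <;> grind

/-- The symmetric group has the Coxeter presentation of type `A`. -/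
theorem exists_hom_perm_of_isLiftable {X : Type*} [Monoid X] {n : ℕ} {s : Fin n → X}
    (hs : (CoxeterMatrix.A n).IsLiftable s) :
    ∃ τ : Equiv.Perm (Fin (n + 1)) →* X, ∀ i : Fin n, τ (Equiv.swap i.castSucc i.succ) = s i := by
  let cs := (CoxeterMatrix.A n).toCoxeterSystem
  let π := cs.lift ⟨_, isLiftable_swap n⟩
  have hπ : ∀ i, π (cs.simple i) = Equiv.swap i.castSucc i.succ := cs.lift_apply_simple _
  have hsurj : Function.Surjective π := by
    rw [← MonoidHom.mrange_eq_top, ← top_le_iff, ← Equiv.Perm.mclosure_swap_castSucc_succ,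
      Submonoid.closure_le]
    rintro _ ⟨i, rfl⟩
    exact ⟨_, hπ i⟩
  -- The value 1 beyond n is a dummy: the counting lemma looks only at indices below n.
  let t : ℕ → (CoxeterMatrix.A n).Group := fun i => if h : i < n then cs.simple ⟨i, h⟩ else 1
  have ht : ∀ i (h : i < n), t i = cs.simple ⟨i, h⟩ := fun i h => dif_pos h
  -- The Coxeter relations inside the Coxeter group are read off from the identity homomorphism.
  obtain ⟨hsq, hbraid, hcomm⟩ := CoxeterMatrix.isLiftable_A_iff.1 (cs.lift.symm (MonoidHom.id _)).2
  have hsq' : ∀ i < n, t i * t i = 1 := fun i h => by rw [ht i h]; exact hsq ⟨i, h⟩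
  have hinv : ∀ i < n, (t i)⁻¹ = t i := fun i h => inv_eq_of_mul_eq_one_right (hsq' i h)
  have hclosure : Subgroup.closure (t '' Set.Iio n) = ⊤ := by
    rw [← top_le_iff, ← cs.subgroup_closure_range_simple, Subgroup.closure_le]
    rintro _ ⟨i, rfl⟩
    exact Subgroup.subset_closure ⟨i, i.2, ht i i.2⟩
  obtain ⟨hfin, hcard⟩ := card_closure_le_factorial n t hsq'
    (fun i j hij hj => by
      have h := (hcomm ⟨i, by omega⟩ ⟨j, hj⟩ hij).1
      change (cs.simple _ * cs.simple _) ^ 2 = 1 at h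
      rw [← ht, ← ht, pow_two, ← eq_inv_iff_mul_eq_one, mul_inv_rev, hinv j hj,
        hinv i (by omega)] at h
      exact h)
    (fun i hi => by
      have h := (hbraid ⟨i, by omega⟩ ⟨i + 1, hi⟩ rfl).1
      change (cs.simple _ * cs.simple _) ^ 3 = 1 at h
      rw [← ht, ← ht, pow_succ, pow_two, ← mul_assoc, ← mul_assoc, mul_assoc _ (t i),
        mul_assoc _ (t (i + 1)), ← eq_inv_iff_mul_eq_one, mul_inv_rev, mul_inv_rev, hinv _ hi,
        hinv i (by omega)] at h
      exact h)
  rw [hclosure, Subgroup.coe_top] at hfin hcard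
  have : Finite (CoxeterMatrix.A n).Group := Set.finite_univ_iff.1 hfin
  -- π maps a group of at most (n + 1)! elements onto one of exactly (n + 1)!.
  have hbij : Function.Bijective π := hsurj.bijective_of_nat_card_le (by
    rw [Nat.card_perm, Nat.card_fin, ← Set.ncard_univ]
    exact hcard)
  let e := MulEquiv.ofBijective π hbij
  refine ⟨(cs.lift ⟨s, hs⟩).comp e.symm.toMonoidHom, fun i => ?_⟩
  have : e.symm (Equiv.swap i.castSucc i.succ) = cs.simple i := by
    rw [MulEquiv.symm_apply_eq]
    exact (hπ i).symm
  rw [MonoidHom.comp_apply, MulEquiv.toMonoidHom_eq_coe, MonoidHom.coe_coe, this,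
    cs.lift_apply_simple]

end TypeA

/-! ### The cycle and the transposition in the symmetric group -/

section Rotation

theorem coe_finRotate_pow (N i : ℕ) (x : Fin (N + 1)) :
    ((finRotate (N + 1) ^ i) x : ℕ) = (x + i) % (N + 1) := by
  induction i with
  | zero => simp [Nat.mod_eq_of_lt x.2]
  | succ i ih =>
    rw [pow_succ', Equiv.Perm.mul_apply, finRotate_apply, Fin.val_add, ih, Fin.val_one',
      Nat.mod_add_mod, Nat.add_mod_mod, add_assoc]

theorem finRotate_pow_self (N : ℕ) : finRotate (N + 1) ^ (N + 1) = 1 := by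
  ext x
  simp [coe_finRotate_pow, Nat.mod_eq_of_lt x.2]

theorem swap_finRotate_pow_conj (N i : ℕ) (hi : i < N) :
    finRotate (N + 1) ^ i * Equiv.swap 0 1 * (finRotate (N + 1) ^ i)⁻¹ =
      Equiv.swap (Fin.castSucc ⟨i, hi⟩) (Fin.succ ⟨i, hi⟩) := by
  rw [← Equiv.swap_apply_apply]
  congr 1 <;> apply Fin.ext <;> rw [coe_finRotate_pow]
  · simp; omega
  · have : ((1 : Fin (N + 1)) : ℕ) = 1 := by simp; omega
    rw [this]
    simp only [Fin.val_succ]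
    rw [Nat.mod_eq_of_lt (by omega)]
    omega

theorem prod_swap_eq_finRotate (N : ℕ) :
    ((List.range N).map fun i => finRotate (N + 1) ^ i * Equiv.swap 0 1 *
      (finRotate (N + 1) ^ i)⁻¹).prod = finRotate (N + 1) := by
  -- The product of the first k adjacent transpositions is the cycle 0 ↦ 1 ↦ ⋯ ↦ k ↦ 0.
  have key : ∀ k ≤ N, ∀ x : Fin (N + 1), ((((List.range k).map fun i => finRotate (N + 1) ^ i *
      Equiv.swap 0 1 * (finRotate (N + 1) ^ i)⁻¹).prod : Equiv.Perm (Fin (N + 1))) x : ℕ) =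
        if (x : ℕ) < k then (x : ℕ) + 1 else if (x : ℕ) = k then 0 else x := by
    intro k
    induction k with
    | zero => intro _ x; simp
    | succ k ih =>
      intro hk x
      rw [List.range_succ, List.map_append, List.prod_append, List.map_singleton,
        List.prod_singleton, Equiv.Perm.mul_apply, ih (by omega), swap_finRotate_pow_conj N k hk,
        Equiv.swap_apply_def]
      split_ifs <;> simp_all [Fin.ext_iff] <;> omega
  ext x
  rw [key N le_rfl, coe_finRotate]
  have := x.2
  split_ifs <;> simp_all [Fin.ext_iff]; omega

/-- The product telescopes because b is an involution. It serves twice: to verify (ab)ᴺ = 1 for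
permutations, and to recover a from the conjugates of b in Moore's presentation. -/
theorem mul_pow_mul_prod_conj {G : Type*} [Group G] {a b : G} (hb : b ^ 2 = 1) (k : ℕ) :
    (a * b) ^ k * ((List.range k).map fun i => (a ^ i)⁻¹ * b * a ^ i).prod = a ^ k := by
  induction k with
  | zero => simp
  | succ k ih =>
    rw [List.range_succ, List.map_append, List.prod_append, List.map_singleton,
      List.prod_singleton, pow_succ', mul_assoc, ← mul_assoc _ _ ((a ^ k)⁻¹ * b * a ^ k), ih,
      mul_assoc (a ^ k)⁻¹, mul_inv_cancel_left, mul_assoc, ← mul_assoc b b, ← pow_two, hb, one_mul,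
      pow_succ']

theorem finRotate_inv_mul_swap_pow (N : ℕ) :
    ((finRotate (N + 1))⁻¹ * Equiv.swap 0 1) ^ N = 1 := by
  have h := mul_pow_mul_prod_conj (a := (finRotate (N + 1))⁻¹) (b := Equiv.swap 0 1)
    (by rw [pow_two, Equiv.swap_mul_self]) N
  simp only [inv_pow, inv_inv] at h
  rw [prod_swap_eq_finRotate, ← eq_mul_inv_iff_mul_eq, ← mul_inv_rev, ← pow_succ',
    finRotate_pow_self, inv_one] at h
  exact h

end Rotation

/-! ### Moore's presentation -/

section Moore

variable {G : Type*} [Group G] {N : ℕ} {a b : G}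

theorem mul_pow_eq_one_comm {x y : G} {p : ℕ} (h : (x * y) ^ p = 1) : (y * x) ^ p = 1 := by
  have : y * x = y * (x * y) * y⁻¹ := by group
  rw [this, conj_pow, h, mul_one, mul_inv_cancel]

/-- With sᵢ = a⁻ⁱ b aⁱ, the hypotheses are the Coxeter relations between s₀ and sⱼ, since a^(N + 1 -
j) = a⁻ʲ. Conjugation by powers of a carries them to all pairs. -/
theorem isLiftable_conj_pow (hb : b ^ 2 = 1) (ha : a ^ (N + 1) = 1)
    (h3 : (b * a ^ N * b * a) ^ 3 = 1)
    (h2 : ∀ j, 2 ≤ j → j + 1 ≤ N → (b * a ^ (N + 1 - j) * b * a ^ j) ^ 2 = 1) :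
    (CoxeterMatrix.A N).IsLiftable (fun i : Fin N => (a ^ (i : ℕ))⁻¹ * b * a ^ (i : ℕ)) := by
  have hinv : ∀ j ≤ N + 1, a ^ (N + 1 - j) = (a ^ j)⁻¹ := fun j hj =>
    eq_inv_of_mul_eq_one_left (by rw [← pow_add, Nat.sub_add_cancel hj, ha])
  have key : ∀ (i d p : ℕ), (b * (a ^ d)⁻¹ * b * a ^ d) ^ p = 1 →
      ((a ^ i)⁻¹ * b * a ^ i * ((a ^ (i + d))⁻¹ * b * a ^ (i + d))) ^ p = 1 := by
    intro i d p h
    have : (a ^ i)⁻¹ * b * a ^ i * ((a ^ (i + d))⁻¹ * b * a ^ (i + d)) =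
        (a ^ i)⁻¹ * (b * (a ^ d)⁻¹ * b * a ^ d) * ((a ^ i)⁻¹)⁻¹ := by
      rw [add_comm i d, pow_add]
      group
    rw [this, conj_pow, h, mul_one, mul_inv_cancel]
  rw [CoxeterMatrix.isLiftable_A_iff]
  refine ⟨fun i => ?_, fun i j hij => ?_, fun i j hij => ?_⟩
  · have := key i 0 1 (by simpa [pow_two] using hb)
    simpa using this
  · have h : ((a ^ (i : ℕ))⁻¹ * b * a ^ (i : ℕ) * ((a ^ (j : ℕ))⁻¹ * b * a ^ (j : ℕ))) ^ 3 = 1 := by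
      rw [← hij]
      refine key i 1 3 ?_
      rw [← hinv 1 (by omega), Nat.add_sub_cancel, pow_one, h3]
    exact ⟨h, mul_pow_eq_one_comm h⟩
  · have h : ((a ^ (i : ℕ))⁻¹ * b * a ^ (i : ℕ) * ((a ^ (j : ℕ))⁻¹ * b * a ^ (j : ℕ))) ^ 2 = 1 := by
      have hj := j.2
      rw [← Nat.add_sub_cancel' (show (i : ℕ) ≤ j by omega)]
      refine key i _ 2 ?_
      rw [← hinv _ (by omega), h2 _ (by omega) (by omega)]
    exact ⟨h, mul_pow_eq_one_comm h⟩

/-- Moore's presentation of the symmetric group on a cycle and a transposition. -/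
theorem exists_hom_perm_of_moore (hN : 1 ≤ N) (hb : b ^ 2 = 1) (ha : a ^ (N + 1) = 1)
    (hab : (a * b) ^ N = 1) (h3 : (b * a ^ N * b * a) ^ 3 = 1)
    (h2 : ∀ j, 2 ≤ j → j + 1 ≤ N → (b * a ^ (N + 1 - j) * b * a ^ j) ^ 2 = 1) :
    ∃ τ : Equiv.Perm (Fin (N + 1)) →* G,
      τ (finRotate (N + 1))⁻¹ = a ∧ τ (Equiv.swap 0 1) = b := by
  obtain ⟨τ, hτ⟩ := exists_hom_perm_of_isLiftable (isLiftable_conj_pow hb ha h3 h2)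
  refine ⟨τ, ?_, ?_⟩
  -- With (ab)ᴺ = 1 the telescoping identity reads s₀ ⋯ sₙ₋₁ = aᴺ = a⁻¹ (here n = N). The same
  -- product of transpositions is the rotation, so τ sends the inverse rotation to a.
  · have h := mul_pow_mul_prod_conj (a := a) hb N
    rw [hab, one_mul] at h
    rw [map_inv, ← prod_swap_eq_finRotate, map_list_prod, List.map_map, inv_eq_iff_eq_inv,
      eq_inv_iff_mul_eq_one, ← ha, pow_succ, ← h]
    congr 2
    refine List.map_congr_left fun i hi => ?_
    rw [Function.comp_apply, swap_finRotate_pow_conj N i (List.mem_range.1 hi), hτ]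
  · have h := hτ ⟨0, hN⟩
    simp only [pow_zero, inv_one, one_mul, mul_one] at h
    rw [← h, ← swap_finRotate_pow_conj N 0 hN]
    simp

end Moore

/-! ### Axioms for the monoid of a star, and normal forms -/

/-- The data from which all partial isometries of a star with leaves `Fin (N + 1)` are composed,
in an arbitrary monoid: a copy `τ` of the symmetric group on the leaves (a permutation `g` stands
for `x ↦ g⁻¹ x`, since maps act on the right), the idempotents `E S` undefined exactly on the set
`S` of leaves, the idempotent `b` undefined exactly at the centre, and the exchange `c` of the
centre with the leaf `0`. -/
structure StarData (N : ℕ) (M : Type*) [Monoid M] where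
  τ : Equiv.Perm (Fin (N + 1)) →* M
  E : Finset (Fin (N + 1)) → M
  b : M
  c : M
  E_empty : E ∅ = 1
  E_mul_E : ∀ S T, E S * E T = E (S ∪ T)
  τ_mul_E : ∀ g S, τ g * E S = E (S.image g) * τ g
  E_mul_τ : ∀ S g, (∀ x ∉ S, g x = x) → E S * τ g = E S
  b_mul_b : b * b = b
  b_mul_τ : ∀ g, b * τ g = τ g * b
  b_mul_E : ∀ S, b * E S = E S * b
  c_mul_c : c * c = E {0}ᶜ
  c_mul_c_mul_c : c * c * c = c
  E_univ_mul_c : E Finset.univ * c = c * b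
  c_mul_swap_mul_c : c * τ (Equiv.swap 0 1) * c = b * (c * c)
  b_mul_c_sq : b * c * (b * c) = b * c * b

/-- Indices for the normal forms of the partial isometries of a star. -/
inductive StarShape (N : ℕ) : Type
  | fix (S : Finset (Fin (N + 1))) (g : Equiv.Perm (Fin (N + 1)))
  | drop (S : Finset (Fin (N + 1))) (g : Equiv.Perm (Fin (N + 1)))
  | flip (g h : Equiv.Perm (Fin (N + 1)))
  | out (h : Equiv.Perm (Fin (N + 1)))
  | into (g : Equiv.Perm (Fin (N + 1)))

namespace StarData

variable {N : ℕ} {M : Type*} [Monoid M] (D : StarData N M)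

/-- The normal form with a given index. -/
def nf : StarShape N → M
  | .fix S g => D.E S * D.τ g
  | .drop S g => D.E S * D.τ g * D.b
  | .flip g h => D.τ g * D.c * D.τ h
  | .out h => D.E Finset.univ * D.c * D.τ h
  | .into g => D.τ g * D.c * D.E Finset.univ

theorem E_mul_E_self (S : Finset (Fin (N + 1))) : D.E S * D.E S = D.E S := by
  rw [D.E_mul_E, Finset.union_self]

theorem E_univ_mul_E (S : Finset (Fin (N + 1))) :
    D.E Finset.univ * D.E S = D.E Finset.univ := by
  rw [D.E_mul_E, Finset.union_eq_left.2 (Finset.subset_univ S)]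

theorem E_mul_E_univ (S : Finset (Fin (N + 1))) :
    D.E S * D.E Finset.univ = D.E Finset.univ := by
  rw [D.E_mul_E, Finset.union_eq_right.2 (Finset.subset_univ S)]

theorem τ_mul_τ_inv (g : Equiv.Perm (Fin (N + 1))) : D.τ g * D.τ g⁻¹ = 1 := by
  rw [← map_mul, mul_inv_cancel, map_one]

theorem E_mul_τ_eq (S : Finset (Fin (N + 1))) (g : Equiv.Perm (Fin (N + 1))) :
    D.E S * D.τ g = D.τ g * D.E (S.image ⇑g⁻¹) := by
  rw [D.τ_mul_E, Finset.image_image]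
  congr
  simp

theorem τ_mul_E_singleton (g : Equiv.Perm (Fin (N + 1))) (i : Fin (N + 1)) :
    D.τ g * D.E {i} = D.E {g i} * D.τ g := by
  rw [D.τ_mul_E, Finset.image_singleton]

theorem E_univ_mul_τ (g : Equiv.Perm (Fin (N + 1))) : D.E Finset.univ * D.τ g = D.E Finset.univ :=
  D.E_mul_τ _ _ fun x hx => absurd (Finset.mem_univ x) hx

theorem τ_mul_E_univ (g : Equiv.Perm (Fin (N + 1))) :
    D.τ g * D.E Finset.univ = D.E Finset.univ := by
  rw [D.τ_mul_E, Finset.image_univ_of_surjective g.surjective, D.E_univ_mul_τ]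

theorem E_compl_mul_c : D.E {0}ᶜ * D.c = D.c := by rw [← D.c_mul_c, D.c_mul_c_mul_c]

theorem c_mul_E_compl : D.c * D.E {0}ᶜ = D.c := by rw [← D.c_mul_c, ← mul_assoc, D.c_mul_c_mul_c]

theorem union_compl_of_notMem {S : Finset (Fin (N + 1))} (h : 0 ∉ S) : S ∪ {0}ᶜ = {0}ᶜ := by
  rw [Finset.union_eq_right]
  intro x hx
  simp only [Finset.mem_compl, Finset.mem_singleton]
  rintro rfl
  exact h hx

theorem union_compl_of_mem {S : Finset (Fin (N + 1))} (h : 0 ∈ S) : S ∪ {0}ᶜ = Finset.univ := by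
  rw [Finset.eq_univ_iff_forall]
  intro x
  by_cases hx : x = 0 <;> simp [hx, h]

theorem E_mul_c_of_notMem {S : Finset (Fin (N + 1))} (h : 0 ∉ S) : D.E S * D.c = D.c := by
  rw [← D.E_compl_mul_c, ← mul_assoc, D.E_mul_E, union_compl_of_notMem h]

theorem E_mul_c_of_mem {S : Finset (Fin (N + 1))} (h : 0 ∈ S) :
    D.E S * D.c = D.E Finset.univ * D.c := by
  rw [← D.E_compl_mul_c, ← mul_assoc, D.E_mul_E, union_compl_of_mem h, ← mul_assoc, D.E_univ_mul_E]

theorem c_mul_E_of_notMem {S : Finset (Fin (N + 1))} (h : 0 ∉ S) : D.c * D.E S = D.c := by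
  rw [← D.c_mul_E_compl, mul_assoc, D.E_mul_E, Finset.union_comm, union_compl_of_notMem h]

theorem c_mul_E_of_mem {S : Finset (Fin (N + 1))} (h : 0 ∈ S) :
    D.c * D.E S = D.c * D.E Finset.univ := by
  rw [← D.c_mul_E_compl, mul_assoc, D.E_mul_E, Finset.union_comm, union_compl_of_mem h, mul_assoc,
    D.E_mul_E_univ]

theorem c_mul_τ_of_fix {g : Equiv.Perm (Fin (N + 1))} (hg : g 0 = 0) : D.c * D.τ g = D.c := by
  rw [← D.c_mul_E_compl, mul_assoc, D.E_mul_τ]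
  intro x hx
  simp only [Finset.mem_compl, Finset.mem_singleton, not_not] at hx
  rw [hx, hg]

theorem τ_mul_c_of_fix {g : Equiv.Perm (Fin (N + 1))} (hg : g 0 = 0) : D.τ g * D.c = D.c := by
  have : ({0}ᶜ : Finset (Fin (N + 1))).image g = {0}ᶜ := by
    ext x
    simp only [Finset.mem_image, Finset.mem_compl, Finset.mem_singleton]
    refine ⟨?_, fun hx => ⟨g.symm x, fun h => hx ?_, g.apply_symm_apply x⟩⟩
    · rintro ⟨y, hy, rfl⟩ h
      exact hy (g.injective (h.trans hg.symm))
    · rw [← g.apply_symm_apply x, h, hg]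
  rw [← D.E_compl_mul_c, ← mul_assoc, D.τ_mul_E, this, D.E_mul_τ]
  intro x hx
  simp only [Finset.mem_compl, Finset.mem_singleton, not_not] at hx
  rw [hx, hg]

theorem τ_mul_c_congr {g h : Equiv.Perm (Fin (N + 1))} (hgh : g 0 = h 0) :
    D.τ g * D.c = D.τ h * D.c := by
  have : g = h * (h⁻¹ * g) := by group
  rw [this, map_mul, mul_assoc, D.τ_mul_c_of_fix (by simp [hgh])]

theorem c_mul_τ_congr {g h : Equiv.Perm (Fin (N + 1))} (hgh : g⁻¹ 0 = h⁻¹ 0) :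
    D.c * D.τ g = D.c * D.τ h := by
  have : g = (g * h⁻¹) * h := by group
  rw [this, map_mul, ← mul_assoc, D.c_mul_τ_of_fix]
  rw [Equiv.Perm.mul_apply, ← hgh, Equiv.Perm.inv_def, Equiv.apply_symm_apply]

theorem E_mul_τ_congr {S : Finset (Fin (N + 1))} {g h : Equiv.Perm (Fin (N + 1))}
    (hgh : ∀ x ∉ S, g⁻¹ x = h⁻¹ x) : D.E S * D.τ g = D.E S * D.τ h := by
  have : g = (g * h⁻¹) * h := by group
  rw [this, map_mul, ← mul_assoc, D.E_mul_τ]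
  intro x hx
  rw [Equiv.Perm.mul_apply, ← hgh x hx, Equiv.Perm.inv_def, Equiv.apply_symm_apply]

/-- The centre travels to leaf 0 and then to a leaf other than 0, where c is undefined; deleting all
leaves in between has the same effect. Algebraically, c = c E({0}ᶜ), and moving this idempotent
across τ h makes its set contain 0. -/
theorem c_mul_τ_mul_c {h : Equiv.Perm (Fin (N + 1))} (hh : h 0 ≠ 0) :
    D.c * D.τ h * D.c = D.c * D.E Finset.univ * D.c := by
  have h1 : D.c * D.τ h * D.c = D.c * (D.E {0}ᶜ * D.τ h) * D.c := by
    rw [← mul_assoc, D.c_mul_E_compl]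
  rw [h1, D.E_mul_τ_eq, mul_assoc, mul_assoc (D.τ h), D.E_mul_c_of_mem, ← mul_assoc (D.τ h),
    D.τ_mul_E_univ, mul_assoc]
  exact Finset.mem_image.2 ⟨h 0, by simpa using hh, by simp⟩

/-- The mirror image of the axiom `E_univ_mul_c`. It results from the axiom `c_mul_swap_mul_c`
multiplied by c on the right, with c³ = c; N ≥ 1 is what makes the leaves 0 and 1 distinct. -/
theorem b_mul_c (hN : 1 ≤ N) : D.b * D.c = D.c * D.E Finset.univ := by
  have h0 : Equiv.swap (0 : Fin (N + 1)) 1 0 ≠ 0 := by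
    rw [Equiv.swap_apply_left, Ne, Fin.ext_iff]
    simp; omega
  have h1 : D.c * D.τ (Equiv.swap 0 1) * D.c = D.c * D.E Finset.univ * D.c := D.c_mul_τ_mul_c h0
  have h2 : D.b * D.c = D.c * D.τ (Equiv.swap 0 1) * D.c * D.c := by
    rw [D.c_mul_swap_mul_c, mul_assoc, mul_assoc D.c, ← mul_assoc D.c, D.c_mul_c_mul_c]
  rw [h2, h1, mul_assoc, D.c_mul_c, mul_assoc, D.E_univ_mul_E]

theorem b_mul_c_mul_b_mul_c : D.b * D.c * (D.b * D.c) = D.E Finset.univ * D.b := by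
  rw [mul_assoc, ← mul_assoc D.c, ← D.E_univ_mul_c, mul_assoc, D.c_mul_c, D.E_univ_mul_E,
    D.b_mul_E]

/-- The product of `E univ` and b stands for the empty transformation. It equals (bc)², which the
axiom `b_mul_c_sq` identifies with bcb. -/
theorem zero_mul_c : D.E Finset.univ * D.b * D.c = D.E Finset.univ * D.b := by
  rw [← D.b_mul_E, mul_assoc, D.E_univ_mul_c, ← mul_assoc, ← D.b_mul_c_sq,
    D.b_mul_c_mul_b_mul_c, D.b_mul_E]

theorem c_mul_zero (hN : 1 ≤ N) :
    D.c * (D.E Finset.univ * D.b) = D.E Finset.univ * D.b := by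
  rw [← mul_assoc, ← D.b_mul_c hN, ← D.b_mul_c_sq, D.b_mul_c_mul_b_mul_c]

/-- This lemma and the next ones on E, b and c form the right multiplication table of the normal
forms. Since 1 is a normal form as well, normal forms exhaust any monoid generated by these
elements. -/
theorem nf_mul_τ (p : StarShape N) (k : Equiv.Perm (Fin (N + 1))) :
    ∃ q, D.nf q = D.nf p * D.τ k := by
  rcases p with ⟨S, g⟩ | ⟨S, g⟩ | ⟨g, h⟩ | h | g
  · exact ⟨.fix S (g * k), by simp only [nf, map_mul, mul_assoc]⟩
  · exact ⟨.drop S (g * k), by simp only [nf, map_mul, mul_assoc, D.b_mul_τ]⟩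
  · exact ⟨.flip g (h * k), by simp only [nf, map_mul, mul_assoc]⟩
  · exact ⟨.out (h * k), by simp only [nf, map_mul, mul_assoc]⟩
  · exact ⟨.into g, by simp only [nf, mul_assoc, D.E_univ_mul_τ]⟩

theorem nf_zero : D.nf (.drop Finset.univ 1) = D.E Finset.univ * D.b := by
  simp [nf]

theorem nf_mul_E (hN : 1 ≤ N) (p : StarShape N) (T : Finset (Fin (N + 1))) :
    ∃ q, D.nf q = D.nf p * D.E T := by
  rcases p with ⟨S, g⟩ | ⟨S, g⟩ | ⟨g, h⟩ | h | g
  · exact ⟨.fix (S ∪ T.image g) g, by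
      simp only [nf, mul_assoc, D.τ_mul_E]; rw [← mul_assoc, D.E_mul_E]⟩
  · refine ⟨.drop (S ∪ T.image g) g, ?_⟩
    simp only [nf, mul_assoc, D.b_mul_E]
    rw [← mul_assoc (D.τ g), D.τ_mul_E, ← D.E_mul_E]
    simp only [mul_assoc]
  · by_cases h0 : 0 ∈ T.image h
    · exact ⟨.into g, by
        simp only [nf, mul_assoc, D.τ_mul_E]
        rw [← mul_assoc D.c (D.E (T.image h)), D.c_mul_E_of_mem h0, mul_assoc, D.E_univ_mul_τ]⟩
    · exact ⟨.flip g h, by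
        simp only [nf, mul_assoc, D.τ_mul_E]
        rw [← mul_assoc D.c (D.E (T.image h)), D.c_mul_E_of_notMem h0]⟩
  · by_cases h0 : 0 ∈ T.image h
    -- The image of the centre is deleted, so the product is the empty transformation.
    · refine ⟨.drop Finset.univ 1, ?_⟩
      rw [nf_zero]
      simp only [nf, mul_assoc, D.τ_mul_E]
      rw [← mul_assoc D.c (D.E (T.image h)), D.c_mul_E_of_mem h0, mul_assoc, D.E_univ_mul_τ,
        ← D.b_mul_c hN, ← mul_assoc, D.zero_mul_c]
    · exact ⟨.out h, by
        simp only [nf, mul_assoc, D.τ_mul_E]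
        rw [← mul_assoc D.c (D.E (T.image h)), D.c_mul_E_of_notMem h0]⟩
  · exact ⟨.into g, by simp only [nf, mul_assoc, D.E_univ_mul_E]⟩

theorem nf_mul_b (hN : 1 ≤ N) (p : StarShape N) : ∃ q, D.nf q = D.nf p * D.b := by
  rcases p with ⟨S, g⟩ | ⟨S, g⟩ | ⟨g, h⟩ | h | g
  · exact ⟨.drop S g, rfl⟩
  · exact ⟨.drop S g, by simp only [nf, mul_assoc, D.b_mul_b]⟩
  · refine ⟨.out h, ?_⟩
    simp only [nf, mul_assoc]
    rw [← D.b_mul_τ, ← mul_assoc D.c, ← D.E_univ_mul_c, ← mul_assoc, ← mul_assoc, ← mul_assoc,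
      D.τ_mul_E_univ]
  · refine ⟨.out h, ?_⟩
    simp only [nf, mul_assoc]
    rw [← D.b_mul_τ, ← mul_assoc D.c, ← D.E_univ_mul_c, ← mul_assoc, ← mul_assoc, ← mul_assoc,
      D.E_univ_mul_E]
  · refine ⟨.drop Finset.univ 1, ?_⟩
    rw [nf_zero]
    simp only [nf, mul_assoc]
    rw [D.c_mul_zero hN, ← mul_assoc, D.τ_mul_E_univ]

theorem nf_mul_c (hN : 1 ≤ N) (p : StarShape N) : ∃ q, D.nf q = D.nf p * D.c := by
  rcases p with ⟨S, g⟩ | ⟨S, g⟩ | ⟨g, h⟩ | h | g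
  · simp only [nf]
    by_cases h0 : 0 ∈ S.image ⇑g⁻¹
    · refine ⟨.out 1, ?_⟩
      rw [D.E_mul_τ_eq, mul_assoc, D.E_mul_c_of_mem h0, ← mul_assoc, D.τ_mul_E_univ]
      simp
    · refine ⟨.flip g 1, ?_⟩
      rw [D.E_mul_τ_eq, mul_assoc, D.E_mul_c_of_notMem h0]
      simp
  · simp only [nf]
    rw [mul_assoc, D.b_mul_c hN, ← mul_assoc]
    by_cases h0 : 0 ∈ S.image ⇑g⁻¹
    · refine ⟨.drop Finset.univ 1, ?_⟩
      simp only [map_one, mul_one]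
      rw [D.E_mul_τ_eq, mul_assoc _ _ D.c, D.E_mul_c_of_mem h0, ← mul_assoc,
        D.τ_mul_E_univ, mul_assoc, ← D.b_mul_c hN, ← mul_assoc, D.zero_mul_c]
    · refine ⟨.into g, ?_⟩
      rw [D.E_mul_τ_eq, mul_assoc _ _ D.c, D.E_mul_c_of_notMem h0]
  · simp only [nf]
    by_cases h0 : h 0 = 0
    · refine ⟨.fix (({0}ᶜ : Finset (Fin (N + 1))).image g) g, ?_⟩
      rw [mul_assoc, D.τ_mul_c_of_fix h0, mul_assoc, D.c_mul_c, D.τ_mul_E]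
    · refine ⟨.drop (({0}ᶜ : Finset (Fin (N + 1))).image g) g, ?_⟩
      rw [mul_assoc (D.τ g), mul_assoc (D.τ g), D.c_mul_τ_mul_c h0, ← D.b_mul_c hN, mul_assoc D.b,
        D.c_mul_c, D.b_mul_E, ← mul_assoc, D.τ_mul_E]
  · simp only [nf]
    by_cases h0 : h 0 = 0
    · refine ⟨.fix Finset.univ 1, ?_⟩
      rw [mul_assoc, D.τ_mul_c_of_fix h0, mul_assoc, D.c_mul_c, D.E_univ_mul_E]
      simp
    · refine ⟨.drop Finset.univ 1, ?_⟩
      simp only [map_one, mul_one]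
      rw [mul_assoc (D.E _), mul_assoc (D.E _), D.c_mul_τ_mul_c h0, ← D.b_mul_c hN, mul_assoc D.b,
        D.c_mul_c, D.b_mul_E, ← mul_assoc, D.E_univ_mul_E]
  · refine ⟨.drop (({0}ᶜ : Finset (Fin (N + 1))).image g) g, ?_⟩
    simp only [nf]
    rw [mul_assoc (D.τ g), mul_assoc (D.τ g), ← D.b_mul_c hN, mul_assoc D.b,
        D.c_mul_c, D.b_mul_E, ← mul_assoc, D.τ_mul_E]

end StarData

/-- A permutation that fixes all points outside p is a permutation of the subtype, hence a product
of transpositions there. -/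
theorem Equiv.Perm.mem_of_swap_mem {α : Type*} [Finite α] [DecidableEq α]
    (C : Submonoid (Equiv.Perm α)) (p : α → Prop)
    (hC : ∀ i j, p i → p j → i ≠ j → Equiv.swap i j ∈ C) (g : Equiv.Perm α)
    (hg : ∀ x, ¬ p x → g x = x) : g ∈ C := by
  classical
  have h1 : ∀ x, p (g x) ↔ p x := by
    intro x
    by_cases hx : p x
    · refine iff_of_true ?_ hx
      by_contra hgx
      exact hgx (by rwa [g.injective (hg _ hgx)])
    · rw [hg x hx]
  have h2 : Equiv.Perm.ofSubtype (g.subtypePerm h1) = g :=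
    Equiv.Perm.ofSubtype_subtypePerm h1 fun x hx => by
      by_contra h
      exact hx (hg x h)
  rw [← h2]
  generalize g.subtypePerm h1 = k
  induction k using Equiv.Perm.swap_induction_on with
  | one => rw [map_one]; exact C.one_mem
  | swap_mul f x y hxy hf =>
    rw [map_mul, Equiv.Perm.ofSubtype_swap_eq]
    exact C.mul_mem (hC _ _ x.2 y.2 fun h => hxy (Subtype.ext h)) hf

/-! ### The symmetric inverse monoid on the leaves -/

section Rook

variable {N : ℕ} {M : Type*} [Monoid M] (τ : Equiv.Perm (Fin (N + 1)) →* M)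

/-- The permutations whose images under `τ` commute with `e`. -/
def permCentralizer (e : M) : Subgroup (Equiv.Perm (Fin (N + 1))) where
  carrier := {g | τ g * e = e * τ g}
  one_mem' := by simp
  mul_mem' := by
    intro g h hg hh
    simp only [Set.mem_ofPred_eq] at *
    rw [map_mul, mul_assoc, hh, ← mul_assoc, hg, mul_assoc]
  inv_mem' := by
    intro g hg
    simp only [Set.mem_ofPred_eq] at *
    calc τ g⁻¹ * e = τ g⁻¹ * (e * τ g) * τ g⁻¹ := by
          rw [mul_assoc, mul_assoc, ← map_mul, mul_inv_cancel, map_one, mul_one]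
      _ = e * τ g⁻¹ := by
          rw [← hg, ← mul_assoc (τ g⁻¹), ← map_mul, inv_mul_cancel, map_one, one_mul]

theorem mem_permCentralizer {e : M} {g : Equiv.Perm (Fin (N + 1))} :
    g ∈ permCentralizer τ e ↔ τ g * e = e * τ g := Iff.rfl

theorem swap_mem_of_adjacent (C : Subgroup (Equiv.Perm (Fin (N + 1))))
    (hC : ∀ i (hi : i < N), 1 ≤ i → Equiv.swap (Fin.castSucc ⟨i, hi⟩) (Fin.succ ⟨i, hi⟩) ∈ C)
    (i j : Fin (N + 1)) (hi : i ≠ 0) (hij : i < j) : Equiv.swap i j ∈ C := by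
  obtain ⟨i, hiN⟩ := i
  obtain ⟨j, hjN⟩ := j
  have hi' : 1 ≤ i := Nat.one_le_iff_ne_zero.2 fun h => hi (Fin.ext h)
  have hij' : i + 1 ≤ j := hij
  clear hij hi
  induction j, hij' using Nat.le_induction with
  | base => exact hC i (by omega) hi'
  | succ j hj ih =>
    have h1 := hC j (by omega) (by omega)
    have h2 : Equiv.swap (⟨i, hiN⟩ : Fin (N + 1)) ⟨j + 1, hjN⟩ =
        Equiv.swap (Fin.castSucc ⟨j, by omega⟩) (Fin.succ ⟨j, by omega⟩) *
          Equiv.swap ⟨i, hiN⟩ ⟨j, by omega⟩ *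
          (Equiv.swap (Fin.castSucc ⟨j, by omega⟩) (Fin.succ ⟨j, by omega⟩))⁻¹ := by
      rw [← Equiv.swap_apply_apply]
      congr 1
      · rw [Equiv.swap_apply_of_ne_of_ne] <;> simp [Fin.ext_iff] <;> omega
      · exact (Equiv.swap_apply_left _ _).symm
    rw [h2]
    exact C.mul_mem (C.mul_mem h1 (ih _)) (C.inv_mem h1)

/-- Write r for the rotation, s for the transposition of 0 and 1, e = r p r⁻¹. The first relation
says that r s r⁻¹ = (1 2) commutes with e, the second that s r does. Now s r is the cycle 1 ↦ 2 ↦ ⋯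
↦ N ↦ 1, so conjugating (1 2) by it yields all adjacent transpositions away from 0, which generate
the stabilizer of 0. -/
theorem stabilizer_le_permCentralizer {p : M} (hN : 2 ≤ N)
    (hcomm : τ (Equiv.swap 0 1) * p = p * τ (Equiv.swap 0 1))
    (hconj : τ (finRotate (N + 1))⁻¹ * τ (Equiv.swap 0 1) * τ (finRotate (N + 1)) * p *
      τ (finRotate (N + 1))⁻¹ * τ (Equiv.swap 0 1) * τ (finRotate (N + 1)) =
        τ (finRotate (N + 1)) * p * τ (finRotate (N + 1))⁻¹)
    (g : Equiv.Perm (Fin (N + 1))) (hg : g 0 = 0) :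
    g ∈ permCentralizer τ (τ (finRotate (N + 1)) * p * τ (finRotate (N + 1))⁻¹) := by
  set r := finRotate (N + 1) with hr
  set s : Equiv.Perm (Fin (N + 1)) := Equiv.swap 0 1 with hs
  set C := permCentralizer τ (τ r * p * τ r⁻¹) with hC
  have hss : τ s * τ s = 1 := by rw [← map_mul, Equiv.swap_mul_self, map_one]
  have hrr : τ r * τ r⁻¹ = 1 := by rw [← map_mul, mul_inv_cancel, map_one]
  have hrr' : τ r⁻¹ * τ r = 1 := by rw [← map_mul, inv_mul_cancel, map_one]
  have hq : s * r ∈ C := by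
    rw [← inv_mem_iff, mul_inv_rev, hs, Equiv.swap_inv, ← hs, hC, mem_permCentralizer, map_mul]
    calc τ r⁻¹ * τ s * (τ r * p * τ r⁻¹)
        = (τ r⁻¹ * τ s * τ r * p * τ r⁻¹ * τ s * τ r) * τ r⁻¹ * τ s := by
          simp only [mul_assoc]
          rw [← mul_assoc (τ r) (τ r⁻¹), hrr, one_mul, hss, mul_one]
      _ = τ r * p * τ r⁻¹ * (τ r⁻¹ * τ s) := by rw [hconj]; simp only [mul_assoc]
  have val_r : ∀ x : Fin (N + 1), (x : ℕ) < N → (r x : ℕ) = x + 1 := fun x hx => by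
    rw [hr, coe_finRotate_of_ne_last]
    rw [Ne, Fin.ext_iff, Fin.val_last]
    omega
  have fix_of_two_le : ∀ x : Fin (N + 1), 2 ≤ (x : ℕ) → s x = x := fun x hx => by
    have e1 : ((1 : Fin (N + 1)) : ℕ) = 1 := by simp; omega
    rw [hs, Equiv.swap_apply_of_ne_of_ne] <;> rw [Ne, Fin.ext_iff]
    · rw [Fin.val_zero]; omega
    · rw [e1]; omega
  have hadj : ∀ i (hi : i < N), 1 ≤ i →
      Equiv.swap (Fin.castSucc ⟨i, hi⟩) (Fin.succ ⟨i, hi⟩) ∈ C := by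
    intro i hi h1
    induction i, h1 using Nat.le_induction with
    | base =>
      rw [← swap_finRotate_pow_conj N 1 hi, pow_one, ← hr, ← hs, hC, mem_permCentralizer, map_mul,
        map_mul]
      calc τ r * τ s * τ r⁻¹ * (τ r * p * τ r⁻¹) = τ r * (τ s * p) * τ r⁻¹ := by
            simp only [mul_assoc]
            rw [← mul_assoc (τ r⁻¹) (τ r), hrr', one_mul]
        _ = τ r * p * τ r⁻¹ * (τ r * τ s * τ r⁻¹) := by
            rw [hcomm]
            simp only [mul_assoc]
            rw [← mul_assoc (τ r⁻¹) (τ r), hrr', one_mul]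
    | succ i h1 ih =>
      have h := C.mul_mem (C.mul_mem hq (ih (by omega))) (C.inv_mem hq)
      rw [← Equiv.swap_apply_apply, Equiv.Perm.mul_apply, Equiv.Perm.mul_apply] at h
      convert h using 2
      · refine (Fin.ext ?_ : _ = r _).trans (fix_of_two_le _ ?_).symm
        · rw [val_r _ (by simp; omega)]; simp
        · rw [val_r _ (by simp; omega)]; simp; omega
      · refine (Fin.ext ?_ : _ = r _).trans (fix_of_two_le _ ?_).symm
        · rw [val_r _ (by simp; omega)]; simp
        · rw [val_r _ (by simp; omega)]; simp
  refine Equiv.Perm.mem_of_swap_mem C.toSubmonoid (fun x => x ≠ 0) ?_ g ?_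
  · intro i j hi hj hij
    rcases lt_or_gt_of_ne hij with h | h
    · exact swap_mem_of_adjacent C hadj i j hi h
    · rw [Equiv.swap_comm]
      exact swap_mem_of_adjacent C hadj j i hj h
  · intro x hx
    rw [not_not.1 hx, hg]

end Rook

section Rook

variable {N : ℕ} {M : Type*} [Monoid M] (τ : Equiv.Perm (Fin (N + 1)) →* M)

theorem pair_transitive {α : Type*} [DecidableEq α] {x y i j : α} (hxy : x ≠ y) (hij : i ≠ j) :
    ∃ g : Equiv.Perm α, g x = i ∧ g y = j := by
  refine ⟨Equiv.swap (Equiv.swap x i y) j * Equiv.swap x i, ?_, ?_⟩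
  · rw [Equiv.Perm.mul_apply, Equiv.swap_apply_left, Equiv.swap_apply_of_ne_of_ne _ hij]
    intro h
    have : Equiv.swap x i x = Equiv.swap x i y := by rw [Equiv.swap_apply_left, ← h]
    exact hxy ((Equiv.swap x i).injective this)
  · rw [Equiv.Perm.mul_apply, Equiv.swap_apply_left]

/-- The conjugates of an idempotent that commutes with the stabilizer of `0`, and their products:
these idempotents and the symmetric group make up a copy of the symmetric inverse monoid. -/
theorem exists_idempotents {e : M} (hN : 1 ≤ N) (he : e * e = e)
    (hstab : ∀ g : Equiv.Perm (Fin (N + 1)), g 0 = 0 → τ g * e = e * τ g)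
    (hsq : (e * τ (Equiv.swap 0 1)) ^ 2 = (τ (Equiv.swap 0 1) * e) ^ 2)
    (habs : e * τ (Equiv.swap 0 1) * e = (τ (Equiv.swap 0 1) * e) ^ 2) :
    ∃ E : Finset (Fin (N + 1)) → M, E {0} = e ∧ E ∅ = 1 ∧ (∀ S T, E S * E T = E (S ∪ T)) ∧
      (∀ g S, τ g * E S = E (S.image g) * τ g) ∧
      (∀ S g, (∀ x ∉ S, g x = x) → E S * τ g = E S) := by
  have hinv : ∀ g, τ g⁻¹ * τ g = 1 := fun g => by rw [← map_mul, inv_mul_cancel, map_one]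
  let f : Fin (N + 1) → M := fun i => τ (Equiv.swap 0 i) * e * τ (Equiv.swap 0 i)⁻¹
  -- A conjugate of e depends only on the image of 0, because e commutes with the stabilizer of 0.
  have hf : ∀ g, τ g * e * τ g⁻¹ = f (g 0) := by
    intro g
    have h : g = Equiv.swap 0 (g 0) * ((Equiv.swap 0 (g 0))⁻¹ * g) := by group
    have hk := hstab ((Equiv.swap 0 (g 0))⁻¹ * g) (by simp)
    generalize (Equiv.swap 0 (g 0))⁻¹ * g = k at h hk
    calc τ g * e * τ g⁻¹
        = τ (Equiv.swap 0 (g 0)) * (τ k * e) * (τ k⁻¹ * τ (Equiv.swap 0 (g 0))⁻¹) := by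
          rw [← map_mul, ← mul_inv_rev, ← h, ← mul_assoc, ← map_mul, ← h]
      _ = f (g 0) := by
          rw [hk]
          simp only [mul_assoc, f]
          rw [← mul_assoc (τ k), ← map_mul, mul_inv_cancel, map_one, one_mul]
  have hf0 : f 0 = e := by
    rw [← Equiv.Perm.one_apply (0 : Fin (N + 1)), ← hf, inv_one, map_one, one_mul, mul_one]
  have hτf : ∀ g i, τ g * f i = f (g i) * τ g := by
    intro g i
    have : g i = (g * Equiv.swap 0 i) 0 := by simp
    rw [this, ← hf]
    simp only [map_mul, mul_assoc, mul_inv_rev, hinv, mul_one, f]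
  have hff : ∀ i, f i * f i = f i := by
    intro i
    simp only [mul_assoc, f]
    rw [← mul_assoc (τ (Equiv.swap 0 i)⁻¹), hinv, one_mul, ← mul_assoc e, he]
  clear_value f
  set s : Equiv.Perm (Fin (N + 1)) := Equiv.swap 0 1 with hs
  have hs0 : s 0 = 1 := Equiv.swap_apply_left _ _
  have hss : τ s * τ s = 1 := by rw [← map_mul, Equiv.swap_mul_self, map_one]
  have hsinv : s⁻¹ = s := Equiv.swap_inv _ _
  have hf1 : f 1 = τ s * e * τ s := by rw [← hs0, ← hf, hsinv]
  -- As (es)² = f 0 f 1 and (se)² = f 1 f 0, `hsq` is the commutation of f 0 and f 1. As ese = f 0 f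
  -- 1 s, `habs` then says that f 0 f 1 absorbs s. Double transitivity extends both facts to all
  -- pairs of leaves.
  have h01 : f 0 * f 1 = f 1 * f 0 := by
    rw [pow_two, pow_two] at hsq
    rw [hf0, hf1]
    simpa only [mul_assoc] using hsq
  have h01s : f 0 * f 1 * τ s = f 0 * f 1 := by
    rw [h01, hf1, hf0]
    rw [pow_two] at habs
    have h : τ s * e * τ s * e = e * τ s * e := by rw [habs, mul_assoc]
    rw [h]
    calc e * τ s * e * τ s = (e * τ s) ^ 2 := by rw [pow_two, mul_assoc (e * τ s)]
      _ = e * τ s * e := by rw [hsq, habs, pow_two]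
  have h1 : (0 : Fin (N + 1)) ≠ 1 := by
    rw [Ne, Fin.ext_iff]
    simp; omega
  have hcomm : ∀ i j, f i * f j = f j * f i := by
    intro i j
    rcases eq_or_ne i j with rfl | hij
    · rfl
    · obtain ⟨g, rfl, rfl⟩ := pair_transitive h1 hij
      have hg : ∀ x, f (g x) = τ g * f x * τ g⁻¹ := fun x => by
        rw [hτf, mul_assoc, ← map_mul, mul_inv_cancel, map_one, mul_one]
      have hgg : ∀ x y, f (g x) * f (g y) = τ g * (f x * f y) * τ g⁻¹ := fun x y => by
        rw [hg, hg]
        simp only [mul_assoc]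
        rw [← mul_assoc (τ g⁻¹) (τ g), hinv, one_mul]
      rw [hgg, hgg, h01]
  have hswap : ∀ i j, i ≠ j → f i * f j * τ (Equiv.swap i j) = f i * f j := by
    intro i j hij
    obtain ⟨g, rfl, rfl⟩ := pair_transitive h1 hij
    have h2 : f (g 0) * f (g 1) = τ g * (f 0 * f 1) * τ g⁻¹ := by
      rw [← mul_assoc (τ g) (f 0), hτf g 0, mul_assoc (f (g 0)) (τ g) (f 1), hτf g 1,
        ← mul_assoc, mul_assoc _ (τ g), ← map_mul, mul_inv_cancel, map_one τ, mul_one]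
    rw [Equiv.swap_apply_apply, map_mul, map_mul, h2, ← hs]
    calc τ g * (f 0 * f 1) * τ g⁻¹ * (τ g * τ s * τ g⁻¹)
        = τ g * (f 0 * f 1 * τ s) * τ g⁻¹ := by
          simp only [mul_assoc]
          rw [← mul_assoc (τ g⁻¹) (τ g), hinv, one_mul]
      _ = τ g * (f 0 * f 1) * τ g⁻¹ := by rw [h01s]
  have hpair : ∀ S : Finset (Fin (N + 1)), (S : Set (Fin (N + 1))).Pairwise
      (Function.onFun Commute f) := fun S i _ j _ _ => hcomm i j
  let E : Finset (Fin (N + 1)) → M := fun S => S.noncommProd f (hpair S)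
  have hEf : ∀ i, E {i} = f i := fun i => Finset.noncommProd_singleton _ _
  have hE0 : E ∅ = 1 := Finset.noncommProd_empty _ _
  have hins' : ∀ i S, i ∉ S → E (insert i S) = f i * E S := fun i S hi =>
    Finset.noncommProd_insert_of_notMem _ _ _ _ hi
  have hins : ∀ i S, f i * E S = E (insert i S) := by
    intro i S
    by_cases hi : i ∈ S
    · rw [← Finset.insert_erase hi, hins' _ _ (Finset.notMem_erase i S), ← mul_assoc, hff,
        ← hins' _ _ (Finset.notMem_erase i S), Finset.insert_idem]
    · exact (hins' i S hi).symm
  have hmul : ∀ S T, E S * E T = E (S ∪ T) := by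
    intro S T
    induction S using Finset.induction_on with
    | empty => rw [hE0, one_mul, Finset.empty_union]
    | insert i S hi ih => rw [hins' i S hi, mul_assoc, ih, hins, Finset.insert_union]
  refine ⟨E, by rw [hEf, hf0], hE0, hmul, fun g S => ?_, fun S g hg => ?_⟩
  · induction S using Finset.induction_on with
    | empty => rw [Finset.image_empty, hE0, one_mul, mul_one]
    | insert i S hi ih =>
      rw [hins' i S hi, ← mul_assoc, hτf, mul_assoc, ih, ← mul_assoc, hins, Finset.image_insert]
  · let C : Submonoid (Equiv.Perm (Fin (N + 1))) :=
      { carrier := {g | E S * τ g = E S}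
        one_mem' := by simp
        mul_mem' := by
          intro g h hg hh
          simp only [Set.mem_ofPred_eq] at *
          rw [map_mul, ← mul_assoc, hg, hh] }
    refine Equiv.Perm.mem_of_swap_mem C (fun x => x ∈ S) (fun i j hi hj hij => ?_) g hg
    have h : E S = E S * (f i * f j) := by
      rw [← hEf, ← hEf, hmul, hmul, Finset.union_eq_left.2]
      intro x
      simp only [Finset.mem_union, Finset.mem_singleton]
      rintro (rfl | rfl) <;> assumption
    change E S * τ (Equiv.swap i j) = E S
    rw [h, mul_assoc, hswap i j hij]

end Rook

section Rook

variable {N : ℕ} {M : Type*} [Monoid M]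

/-- Each further factor rotates the deleted set down by one and deletes the last leaf anew, so after
j steps the last j + 1 leaves are gone. For j = N - 1 only leaf 0 survives. -/
theorem last_mul_rotate_pow (τ : Equiv.Perm (Fin (N + 1)) →* M) (E : Finset (Fin (N + 1)) → M)
    (hmul : ∀ S T, E S * E T = E (S ∪ T)) (hτ : ∀ g S, τ g * E S = E (S.image g) * τ g)
    (j : ℕ) (hj : j ≤ N) :
    (E {Fin.last N} * τ (finRotate (N + 1))⁻¹) ^ j * E {Fin.last N} =
      E (Finset.univ.filter fun x => N ≤ (x : ℕ) + j) * τ (finRotate (N + 1))⁻¹ ^ j := by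
  induction j with
  | zero =>
    rw [pow_zero, one_mul, pow_zero, mul_one]
    congr 1
    ext x
    have := x.2
    simp [Fin.ext_iff]
    omega
  | succ j ih =>
    rw [pow_succ', mul_assoc, ih (by omega), mul_assoc, ← mul_assoc (τ _), hτ, ← mul_assoc,
      ← mul_assoc, hmul, mul_assoc, ← pow_succ']
    congr 2
    ext x
    have hx := x.2
    simp only [Finset.mem_union, Finset.mem_singleton, Finset.mem_image, Finset.mem_filter,
      Finset.mem_univ, true_and]
    have hr : ∀ y, ((finRotate (N + 1))⁻¹ y = x) ↔ y = finRotate (N + 1) x := fun y => by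
      rw [Equiv.Perm.inv_eq_iff_eq]
    simp only [hr, exists_eq_right, coe_finRotate]
    split_ifs with h
    · simp [h]
    · simp only [h, false_or]
      omega

theorem filter_eq_compl_zero (hN : 1 ≤ N) :
    (Finset.univ.filter fun x : Fin (N + 1) => N ≤ (x : ℕ) + (N - 1)) = {0}ᶜ := by
  ext x
  simp only [Finset.mem_filter, Finset.mem_univ, true_and, Finset.mem_compl, Finset.mem_singleton,
    Fin.ext_iff, Fin.val_zero]
  omega

end Rook

/-! ### From the relations to the axioms -/

theorem finRotate_inv_mul_swap_apply_zero {N : ℕ} :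
    ((finRotate (N + 1))⁻¹ * Equiv.swap 0 1 : Equiv.Perm (Fin (N + 1))) 0 = 0 := by
  rw [Equiv.Perm.mul_apply, Equiv.swap_apply_left, Equiv.Perm.inv_eq_iff_eq, finRotate_apply,
    zero_add]

/-- The letters of the presentation are the corresponding components of `D`. -/
structure StarData.Compatible {N : ℕ} {M : Type*} [Monoid M] (D : StarData N M)
    (v : DPS.Letter → M) : Prop where
  a₁ : D.τ (finRotate (N + 1))⁻¹ = v .a₁
  a₂ : D.τ (Equiv.swap 0 1) = v .a₂
  b₁ : D.E {Fin.last N} = v .b₁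
  b₂ : D.b = v .b₂
  c : D.c = v .c

namespace DPS

/-- Unfolds the relations for n = N + 2 into identities in M, to be used both as hypotheses and as
goals. -/
theorem forall_relations_iff {N : ℕ} {M : Type*} [Monoid M] (v : Letter → M) :
    (∀ p ∈ relations (N + 2), FreeMonoid.lift v p.1 = FreeMonoid.lift v p.2) ↔
      ((((((v .a₂ ^ 2 = 1 ∧
        v .a₁ ^ (N + 1) = 1 ∧
        (v .a₁ * v .a₂) ^ N = 1 ∧
        (v .a₂ * v .a₁ ^ N * v .a₂ * v .a₁) ^ 3 = 1) ∧
      ∀ ⦃j : ℕ⦄, j ∈ Set.Icc 2 (N - 1) →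
        (v .a₂ * v .a₁ ^ (N + 1 - j) * v .a₂ * v .a₁ ^ j) ^ 2 = 1) ∧
      v .b₁ ^ 2 = v .b₁ ∧
        v .b₂ ^ 2 = v .b₂ ∧
        v .a₂ * v .b₁ = v .b₁ * v .a₂ ∧
        v .b₂ * v .a₂ = v .a₂ * v .b₂ ∧
        v .b₂ * v .a₁ = v .a₁ * v .b₂ ∧
        v .b₂ * v .b₁ = v .b₁ * v .b₂ ∧
        v .a₁ * v .a₂ * v .a₁ ^ N * v .b₁ * v .a₁ * v .a₂ * v .a₁ ^ N =
          v .a₁ ^ N * v .b₁ * v .a₁ ∧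
        (v .a₁ ^ N * v .b₁ * v .a₁ * v .a₂) ^ 2 = (v .a₂ * v .a₁ ^ N * v .b₁ * v .a₁) ^ 2 ∧
        v .a₁ ^ N * v .b₁ * v .a₁ * v .a₂ * v .a₁ ^ N * v .b₁ * v .a₁ =
          (v .a₂ * v .a₁ ^ N * v .b₁ * v .a₁) ^ 2 ∧
        v .c ^ 3 = v .c ∧
        v .c * v .a₁ = v .c * v .a₂ ∧
        v .a₁ ^ N * v .c = v .a₂ * v .c) ∧
      ∀ ⦃j : ℕ⦄, j ∈ Set.Icc 1 (N - 1) → v .a₂ * v .a₁ ^ j * v .c = v .a₁ ^ j * v .c) ∧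
      v .b₁ * v .a₁ * v .c = v .c * v .b₂) ∧
      ∀ ⦃j : ℕ⦄, j ∈ Set.Icc 2 (N - 1) → v .b₁ * v .a₁ ^ j * v .c = v .a₁ ^ j * v .c) ∧
      (v .b₁ * v .a₁) ^ (N - 1) * v .b₁ = v .c ^ 2 * v .a₂ * v .a₁ ^ (N - 2) ∧
        v .b₂ * v .c ^ 2 = v .c * v .a₂ * v .c ∧
        (v .b₂ * v .c) ^ 2 = v .b₂ * v .c * v .b₂ := by
  simp only [relations, Set.mem_union, or_imp, forall_and, Set.mem_insert_iff, forall_eq,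
    Set.forall_mem_image, Set.mem_singleton_iff, map_mul, map_pow, map_one,
    FreeMonoid.lift_eval_of]
  exact Iff.rfl

theorem exists_hom_of_relations {N : ℕ} {M : Type*} [Monoid M] (hN : 2 ≤ N) (v : Letter → M)
    (hv : ∀ p ∈ relations (N + 2), FreeMonoid.lift v p.1 = FreeMonoid.lift v p.2) :
    ∃ τ : Equiv.Perm (Fin (N + 1)) →* M,
      τ (finRotate (N + 1))⁻¹ = v .a₁ ∧ τ (Equiv.swap 0 1) = v .a₂ := by
  obtain ⟨⟨⟨⟨⟨⟨⟨sq_a₂, pow_a₁, pow_a₁_a₂, braid⟩, comm⟩, -⟩, -⟩, -⟩, -⟩, -⟩ :=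
    (forall_relations_iff v).1 hv
  -- The first two relations make a₁ and a₂ invertible, so Moore's presentation applies in the group
  -- of units.
  let A : Mˣ := ⟨v .a₁, v .a₁ ^ N, by rw [← pow_succ', pow_a₁], by rw [← pow_succ, pow_a₁]⟩
  let B : Mˣ := ⟨v .a₂, v .a₂, by rw [← pow_two, sq_a₂], by rw [← pow_two, sq_a₂]⟩
  have hA : (A : M) = v .a₁ := rfl
  have hB : (B : M) = v .a₂ := rfl
  obtain ⟨τ, h1, h2⟩ := exists_hom_perm_of_moore (a := A) (b := B) (N := N) (by omega)
    (Units.ext (by push_cast; rw [hB, sq_a₂])) (Units.ext (by push_cast; rw [hA, pow_a₁]))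
    (Units.ext (by push_cast; rw [hA, hB, pow_a₁_a₂]))
    (Units.ext (by push_cast; rw [hA, hB, braid]))
    (fun j hj hj' => Units.ext (by push_cast; rw [hA, hB, comm ⟨hj, by omega⟩]))
  exact ⟨(Units.coeHom M).comp τ, by simp [h1, hA], by simp [h2, hB]⟩

theorem exists_starData_of_relations {N : ℕ} {M : Type*} [Monoid M] (hN : 2 ≤ N) (v : Letter → M)
    (hv : ∀ p ∈ relations (N + 2), FreeMonoid.lift v p.1 = FreeMonoid.lift v p.2) :
    ∃ D : StarData N M, D.Compatible v := by
  obtain ⟨τ, ha₁, ha₂⟩ := exists_hom_of_relations hN v hv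
  obtain ⟨⟨⟨⟨⟨-, idem_b₁, idem_b₂, comm_a₂_b₁, comm_b₂_a₂, comm_b₂_a₁, comm_b₂_b₁, conj_b₁,
    rel_comm, rel_absorb, cube_c, -, -⟩, -⟩, b₁_a₁_c⟩, -⟩, rank_two, b₂_c_sq, b₂_c_b₂⟩ :=
    (forall_relations_iff v).1 hv
  simp only [← ha₁, ← ha₂] at comm_a₂_b₁ comm_b₂_a₂ comm_b₂_a₁ conj_b₁ rel_comm rel_absorb
  simp only [← ha₁, ← ha₂] at b₁_a₁_c rank_two b₂_c_sq
  set r := finRotate (N + 1) with hr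
  have hrN : τ r⁻¹ ^ N = τ r := by
    rw [← map_pow]
    congr 1
    rw [inv_pow, inv_eq_iff_mul_eq_one, ← pow_succ, hr, finRotate_pow_self]
  have hrr : τ r * τ r⁻¹ = 1 := by rw [← map_mul, mul_inv_cancel, map_one]
  have hrr' : τ r⁻¹ * τ r = 1 := by rw [← map_mul, inv_mul_cancel, map_one]
  rw [hrN] at conj_b₁ rel_comm rel_absorb
  have hstab := stabilizer_le_permCentralizer τ hN comm_a₂_b₁
    (by simpa only [mul_assoc] using conj_b₁)
  -- b₁ deletes the last leaf and the rotation takes that leaf to 0, so this conjugate is the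
  -- idempotent that deletes leaf 0.
  obtain ⟨E, hE0, hE, hmul, hτE, hEτ⟩ := exists_idempotents τ (by omega)
    (e := τ r * v .b₁ * τ r⁻¹) (by
      simp only [mul_assoc]
      rw [← mul_assoc (τ r⁻¹), hrr', one_mul, ← mul_assoc (v .b₁), ← pow_two, idem_b₁])
    hstab (by simpa only [mul_assoc] using rel_comm) (by simpa only [mul_assoc] using rel_absorb)
  have hb₁ : E {Fin.last N} = v .b₁ := by
    have h := hτE r {Fin.last N}
    rw [Finset.image_singleton, hr, finRotate_last, ← hr, hE0, mul_assoc, hrr', mul_one] at h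
    calc E {Fin.last N} = τ r⁻¹ * (τ r * E {Fin.last N}) := by rw [← mul_assoc, hrr', one_mul]
      _ = v .b₁ := by rw [h, ← mul_assoc, hrr', one_mul]
  -- With r the rotation, s = (0 1) and τ omitted, the relation for (b₁a₁)^(n - 3) b₁ reads E({0}ᶜ)
  -- r^-(N-1) = c² s r^-(N-2). Cancelling the power of r leaves E({0}ᶜ) r⁻¹ = c² s, and r⁻¹ s fixes
  -- the one leaf that is not deleted.
  have hcc : v .c * v .c = E {0}ᶜ := by
    have h := last_mul_rotate_pow τ E hmul hτE (N - 1) (by omega)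
    rw [hb₁, ← hr, rank_two, filter_eq_compl_zero (by omega),
      ← Nat.sub_add_cancel (show 1 ≤ N - 1 by omega),
      show N - 1 - 1 = N - 2 by omega, pow_succ' (τ r⁻¹) (N - 2), ← mul_assoc (E _)] at h
    have hu : IsUnit (τ r⁻¹ ^ (N - 2)) := by
      refine IsUnit.pow _ ⟨⟨_, _, hrr', hrr⟩, rfl⟩
    have h' := hu.mul_right_cancel h
    calc v .c * v .c = v .c ^ 2 * τ (Equiv.swap 0 1) * τ (Equiv.swap 0 1) := by
          rw [mul_assoc, ← map_mul, Equiv.swap_mul_self, map_one, mul_one, pow_two]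
      _ = E {0}ᶜ := by
          rw [h', mul_assoc, ← map_mul, hEτ]
          intro x hx
          simp only [Finset.mem_compl, Finset.mem_singleton, not_not] at hx
          rw [hx, hr, finRotate_inv_mul_swap_apply_zero]
  have hccc : v .c * v .c * v .c = v .c := by rw [← pow_two, ← pow_succ, cube_c]
  have hEc : E Finset.univ * v .c = v .c * v .b₂ := by
    have h0 : E {0} * v .c = E Finset.univ * v .c := by
      rw [← hccc, hcc, ← mul_assoc, ← mul_assoc, hmul, hmul, Finset.union_compl,
        Finset.union_eq_left.2 (Finset.subset_univ _)]
    have h1 : E Finset.univ = τ r⁻¹ * E Finset.univ := by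
      rw [hτE, Finset.image_univ_of_surjective (Equiv.surjective _), hEτ _ _ (by simp)]
    have h2 : E {Fin.last N} * τ r⁻¹ = τ r⁻¹ * E {0} := by
      have h3 : r⁻¹ 0 = Fin.last N := by rw [Equiv.Perm.inv_eq_iff_eq, hr, finRotate_last]
      rw [hτE, Finset.image_singleton, h3]
    rw [← b₁_a₁_c, ← hb₁, h2, mul_assoc, h0, ← mul_assoc, ← h1]
  have hbτ : ∀ g, v .b₂ * τ g = τ g * v .b₂ := by
    have hsub : (⊤ : Submonoid (Equiv.Perm (Fin (N + 1)))) ≤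
        (permCentralizer τ (v .b₂)).toSubmonoid := by
      rw [← Equiv.Perm.mclosure_swap_castSucc_succ, Submonoid.closure_le]
      rintro _ ⟨i, rfl⟩
      change Equiv.swap _ _ ∈ permCentralizer τ (v .b₂)
      rw [← swap_finRotate_pow_conj N i i.2]
      have h1 : r ∈ permCentralizer τ (v .b₂) := by
        rw [← inv_mem_iff, mem_permCentralizer, comm_b₂_a₁]
      have h2 : Equiv.swap 0 1 ∈ permCentralizer τ (v .b₂) := by
        rw [mem_permCentralizer, comm_b₂_a₂]
      exact mul_mem (mul_mem (pow_mem h1 _) h2) (inv_mem (pow_mem h1 _))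
    intro g
    exact ((mem_permCentralizer τ).1 (hsub (Submonoid.mem_top g))).symm
  have hbE1 : ∀ i, v .b₂ * E {i} = E {i} * v .b₂ := by
    intro i
    have h : E {i} = τ (Equiv.swap (Fin.last N) i) * v .b₁ * τ (Equiv.swap (Fin.last N) i) := by
      rw [← hb₁, hτE, mul_assoc, ← map_mul, Equiv.swap_mul_self, map_one, mul_one,
        Finset.image_singleton, Equiv.swap_apply_left]
    rw [h, mul_assoc (τ _), ← mul_assoc (v .b₂), hbτ, mul_assoc, ← mul_assoc (v .b₂), comm_b₂_b₁,
      mul_assoc (v .b₁), hbτ]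
    simp only [mul_assoc]
  have hbE : ∀ S, v .b₂ * E S = E S * v .b₂ := by
    intro S
    induction S using Finset.induction_on with
    | empty => rw [hE, one_mul, mul_one]
    | insert i S hi ih =>
      rw [Finset.insert_eq, ← hmul, ← mul_assoc, hbE1, mul_assoc, ih, mul_assoc]
  exact ⟨{ τ := τ, E := E, b := v .b₂, c := v .c, E_empty := hE, E_mul_E := hmul, τ_mul_E := hτE
           E_mul_τ := hEτ, b_mul_b := by rw [← pow_two, idem_b₂]
           b_mul_τ := hbτ, b_mul_E := hbE, c_mul_c := hcc, c_mul_c_mul_c := hccc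
           E_univ_mul_c := hEc, c_mul_swap_mul_c := by rw [← b₂_c_sq, pow_two]
           b_mul_c_sq := by rw [← pow_two, b₂_c_b₂] }, ha₁, ha₂, hb₁, rfl, rfl⟩

end DPS

/-! ### From the axioms to the relations -/

namespace StarData

variable {N : ℕ} {M : Type*} [Monoid M] (D : StarData N M)

/-- Verified from the axioms, the relations need no pointwise computation; applied to `starModel`,
this shows that the actual generators satisfy them. -/
theorem Compatible.satisfies {D : StarData N M} {v : DPS.Letter → M} (hD : D.Compatible v)
    (hN : 2 ≤ N) :
    ∀ p ∈ DPS.relations (N + 2), FreeMonoid.lift v p.1 = FreeMonoid.lift v p.2 := by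
  rw [DPS.forall_relations_iff, ← hD.a₁, ← hD.a₂, ← hD.b₁, ← hD.b₂, ← hD.c]
  set r := finRotate (N + 1) with hr
  set s : Equiv.Perm (Fin (N + 1)) := Equiv.swap 0 1 with hs
  have hrN : r⁻¹ ^ N = r := by
    rw [inv_pow, inv_eq_iff_mul_eq_one, ← pow_succ, hr, finRotate_pow_self]
  have hrj : ∀ j ≤ N + 1, r⁻¹ ^ (N + 1 - j) = r ^ j := fun j hj => by
    rw [inv_pow, inv_eq_iff_mul_eq_one, ← pow_add, Nat.sub_add_cancel hj, hr, finRotate_pow_self]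
  have hss : s * s = 1 := Equiv.swap_mul_self _ _
  have v1 : ((1 : Fin (N + 1)) : ℕ) = 1 := by
    rw [Fin.val_one', Nat.mod_eq_of_lt (by omega)]
  have hs0 : s 0 = 1 := Equiv.swap_apply_left _ _
  have hr0 : r 0 = 1 := by rw [hr, finRotate_apply, zero_add]
  have hrinv : r⁻¹ 1 = 0 := by rw [Equiv.Perm.inv_eq_iff_eq, hr0]
  have hrl : r (Fin.last N) = 0 := finRotate_last
  have hrinv0 : r⁻¹ 0 = Fin.last N := by rw [Equiv.Perm.inv_eq_iff_eq, hrl]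
  have sfix : ∀ x : Fin (N + 1), 2 ≤ (x : ℕ) → s x = x := fun x hx => by
    rw [hs, Equiv.swap_apply_of_ne_of_ne] <;> rw [Ne, Fin.ext_iff]
    · rw [Fin.val_zero]; omega
    · rw [v1]; omega
  have hsl : s (Fin.last N) = Fin.last N := sfix _ (by simpa using hN)
  have hrpow : ∀ j (h1 : 1 ≤ j) (h2 : j ≤ N),
      ((r⁻¹ ^ j) 0 : Fin (N + 1)) = ⟨N + 1 - j, by omega⟩ := by
    intro j h1 h2
    rw [inv_pow, Equiv.Perm.inv_eq_iff_eq, Fin.ext_iff, coe_finRotate_pow]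
    simp only [Fin.val_zero]
    rw [Nat.sub_add_cancel (by omega), Nat.mod_self]
  have hlift := CoxeterMatrix.isLiftable_A_iff.1 (isLiftable_swap N)
  -- The words of Moore's relations are products of two adjacent transpositions, so the Coxeter
  -- relations settle them.
  have hconj : ∀ j (hj : j < N), s * r ^ j * s * r⁻¹ ^ j =
      Equiv.swap (Fin.castSucc ⟨0, by omega⟩) (Fin.succ ⟨0, by omega⟩) *
        Equiv.swap (Fin.castSucc ⟨j, hj⟩) (Fin.succ ⟨j, hj⟩) := by
    intro j hj
    rw [← swap_finRotate_pow_conj N j hj, ← swap_finRotate_pow_conj N 0 (by omega), ← hr, ← hs,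
      inv_pow]
    simp [mul_assoc]
  have hτE : ∀ g i, D.τ g * D.E {i} = D.E {g i} * D.τ g := D.τ_mul_E_singleton
  have hττ : ∀ g h x, D.τ g * (D.τ h * x) = D.τ (g * h) * x := fun g h x => by
    rw [map_mul, mul_assoc]
  have hτE' : ∀ g i x, D.τ g * (D.E {i} * x) = D.E {g i} * (D.τ g * x) := fun g i x => by
    rw [← mul_assoc, hτE, mul_assoc]
  have hE01 : ∀ g, (∀ x, x ≠ 0 → x ≠ 1 → g x = x) → D.E {0, 1} * D.τ g = D.E {0, 1} :=
    fun g hg => D.E_mul_τ _ _ fun x hx => by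
      simp only [Finset.mem_insert, Finset.mem_singleton, not_or] at hx
      exact hg x hx.1 hx.2
  have hEE : D.E {0} * D.E {1} = D.E {0, 1} := D.E_mul_E _ _
  have hEE' : D.E {1} * D.E {0} = D.E {0, 1} := by
    rw [D.E_mul_E, Finset.union_comm, ← D.E_mul_E, hEE]
  have he : D.τ r * D.E {Fin.last N} * D.τ r⁻¹ = D.E {0} := by
    rw [hτE, hrl, mul_assoc, τ_mul_τ_inv, mul_one]
  have hes : D.E {0} * D.τ s * (D.E {0} * D.τ s) = D.E {0, 1} := by
    rw [mul_assoc, hτE', hs0, ← map_mul, hss, map_one, mul_one, hEE]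
  have hse : D.τ s * D.E {0} * (D.τ s * D.E {0}) = D.E {0, 1} := by
    rw [mul_assoc, hτE', hs0, hττ, hss, map_one, one_mul, hEE']
  refine ⟨⟨⟨⟨⟨⟨⟨?_, ?_, ?_, ?_⟩, ?_⟩, ?_, ?_, ?_, ?_, ?_, ?_, ?_, ?_, ?_, ?_, ?_, ?_⟩, ?_⟩, ?_⟩,
    ?_⟩, ?_, ?_, ?_⟩
  · rw [pow_two, ← map_mul, hss, map_one]
  · rw [← map_pow, inv_pow, hr, finRotate_pow_self, inv_one, map_one]
  · rw [← map_mul, ← map_pow, hr, hs, finRotate_inv_mul_swap_pow, map_one]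
  · rw [← map_pow, hrN, ← map_mul, ← map_mul, ← map_mul, ← map_pow]
    have h := hconj 1 (by omega)
    rw [pow_one, pow_one] at h
    rw [h, (hlift.2.1 ⟨0, by omega⟩ ⟨1, by omega⟩ rfl).1, map_one]
  · rintro j ⟨h1, h2⟩
    rw [← map_pow, hrj j (by omega), ← map_mul, ← map_pow, ← map_mul, ← map_mul, ← map_pow,
      hconj j (by omega), (hlift.2.2 ⟨0, by omega⟩ ⟨j, by omega⟩ (by simp; omega)).1, map_one]
  · rw [pow_two, D.E_mul_E_self]
  · rw [pow_two, D.b_mul_b]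
  · rw [hτE, hsl]
  · rw [D.b_mul_τ]
  · rw [D.b_mul_τ]
  · rw [D.b_mul_E]
  · rw [← map_pow, hrN, he]
    simp only [mul_assoc, hτE', ← map_mul]
    have h1 : (r⁻¹ * (s * r)) (Fin.last N) = 0 := by
      rw [Equiv.Perm.mul_apply, Equiv.Perm.mul_apply, hrl, hs0, hrinv]
    have h2 : r⁻¹ * (s * (r * (r⁻¹ * (s * r)))) = 1 := by
      calc _ = r⁻¹ * (s * s) * r := by group
        _ = 1 := by rw [hss]; group
    rw [h1, h2, map_one, mul_one]
  · rw [← map_pow, hrN]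
    have h1 : D.τ s * D.τ r * D.E {Fin.last N} * D.τ r⁻¹ = D.τ s * D.E {0} := by
      rw [← he]; simp only [mul_assoc]
    rw [h1, he, pow_two, pow_two, hes, hse]
  · rw [← map_pow, hrN]
    have h1 : D.τ s * D.τ r * D.E {Fin.last N} * D.τ r⁻¹ = D.τ s * D.E {0} := by
      rw [← he]; simp only [mul_assoc]
    have h2 : ∀ x, x * D.τ r * D.E {Fin.last N} * D.τ r⁻¹ = x * D.E {0} := fun x => by
      rw [← he]; simp only [mul_assoc]
    rw [h2, h1, he, pow_two, hse, mul_assoc, hτE, hs0, ← mul_assoc, hEE, hE01]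
    exact fun x h0 h1 => Equiv.swap_apply_of_ne_of_ne h0 h1
  · rw [pow_succ, pow_two, D.c_mul_c_mul_c]
  · exact D.c_mul_τ_congr (by rw [inv_inv, hr0, hs, Equiv.swap_inv, ← hs, hs0])
  · rw [← map_pow, hrN]
    exact D.τ_mul_c_congr (by rw [hr0, hs0])
  · rintro j ⟨h1, h2⟩
    rw [← map_pow, ← map_mul]
    refine D.τ_mul_c_congr ?_
    rw [Equiv.Perm.mul_apply, hrpow j h1 (by omega), sfix]
    simp only
    omega
  · rw [← hrinv0, ← hτE, mul_assoc, D.E_mul_c_of_mem (by simp), ← mul_assoc, D.τ_mul_E_univ,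
      D.E_univ_mul_c]
  · rintro j ⟨h1, h2⟩
    rw [← map_pow, D.E_mul_τ_eq, mul_assoc, D.E_mul_c_of_notMem]
    rw [Finset.image_singleton, Finset.mem_singleton, eq_comm, Equiv.Perm.inv_eq_iff_eq,
      hrpow j (by omega) (by omega), Fin.ext_iff, Fin.val_last]
    simp only
    omega
  · rw [last_mul_rotate_pow D.τ D.E D.E_mul_E D.τ_mul_E (N - 1) (by omega),
      filter_eq_compl_zero (by omega), pow_two, D.c_mul_c, ← hr, ← map_pow, ← map_pow, mul_assoc,
      ← map_mul]
    -- Leaf 0 alone survives on both sides, so it suffices to follow it: r^(N-1) and r^(N-2) s agree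
    -- at 0, where r is the rotation.
    refine D.E_mul_τ_congr ?_
    intro x hx
    simp only [Finset.mem_compl, Finset.mem_singleton, not_not] at hx
    rw [hx, mul_inv_rev, inv_pow, inv_inv, inv_pow, inv_inv, hs, Equiv.swap_inv, ← hs,
      Equiv.Perm.mul_apply, hs0, ← hr0, ← Equiv.Perm.mul_apply, ← pow_succ,
      show N - 2 + 1 = N - 1 by omega]
  · rw [pow_two, D.c_mul_swap_mul_c]
  · rw [pow_two, D.b_mul_c_sq]

end StarData

/-! ### The model by partial transformations -/

namespace DPS

variable {N : ℕ}

theorem ext_vertices {f g : PartialTransf (Fin (N + 2))} (h0 : f 0 = g 0)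
    (hs : ∀ x : Fin (N + 1), f x.succ = g x.succ) : f = g :=
  PartialTransf.ext (funext fun x => Fin.cases h0 hs x)

/-- The action of a permutation of the leaves on the vertices of the star. -/
def permTransf (g : Equiv.Perm (Fin (N + 1))) : PartialTransf (Fin (N + 2)) :=
  ⟨Fin.cases (some 0) fun x => some (g⁻¹ x).succ⟩

/-- The partial identity undefined exactly on a set of leaves. -/
def leafIdem (S : Finset (Fin (N + 1))) : PartialTransf (Fin (N + 2)) :=
  ⟨Fin.cases (some 0) fun x => if x ∈ S then none else some x.succ⟩

@[simp] theorem permTransf_zero (g : Equiv.Perm (Fin (N + 1))) : permTransf g 0 = some 0 := rfl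

@[simp] theorem permTransf_succ (g : Equiv.Perm (Fin (N + 1))) (x : Fin (N + 1)) :
    permTransf g x.succ = some (g⁻¹ x).succ := rfl

@[simp] theorem leafIdem_zero (S : Finset (Fin (N + 1))) : leafIdem S 0 = some 0 := rfl

@[simp] theorem leafIdem_succ (S : Finset (Fin (N + 1))) (x : Fin (N + 1)) :
    leafIdem S x.succ = if x ∈ S then none else some x.succ := rfl

@[simp] theorem gen_b₂_zero : gen (N + 2) .b₂ 0 = none := rfl

@[simp] theorem gen_b₂_succ (x : Fin (N + 1)) : gen (N + 2) .b₂ x.succ = some x.succ :=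
  if_neg (c := x.succ = 0) (t := none) (Fin.succ_ne_zero x)

@[simp] theorem gen_c_zero : gen (N + 2) .c 0 = some (Fin.succ 0) := rfl

@[simp] theorem gen_c_succ (x : Fin (N + 1)) :
    gen (N + 2) .c x.succ = if x = 0 then some 0 else none := by
  refine (if_neg (c := x.succ = 0) (t := some 1) (Fin.succ_ne_zero x)).trans ?_
  have : (x.succ = 1) ↔ x = 0 := by rw [← Fin.succ_zero_eq_one, Fin.succ_inj]
  change (if x.succ = 1 then some 0 else none) = _
  simp only [this]

@[simp] theorem permTransf_one (g : Equiv.Perm (Fin (N + 1))) :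
    permTransf g 1 = some (g⁻¹ 0).succ := rfl

@[simp] theorem leafIdem_one (S : Finset (Fin (N + 1))) :
    leafIdem S 1 = if 0 ∈ S then none else some 1 := leafIdem_succ S 0

@[simp] theorem gen_b₂_one : gen (N + 2) .b₂ 1 = some 1 := gen_b₂_succ 0

@[simp] theorem gen_c_one : gen (N + 2) .c 1 = some 0 := (gen_c_succ 0).trans (if_pos rfl)

@[simp] theorem one_transf_apply (x : Fin (N + 2)) :
    (1 : PartialTransf (Fin (N + 2))) x = some x := rfl

/-- The model of `StarData` in which every symbol has its intended meaning. -/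
def starModel (hN : 1 ≤ N) : StarData N (PartialTransf (Fin (N + 2))) where
  τ :=
    { toFun := permTransf
      map_one' := ext_vertices rfl fun x => rfl
      map_mul' := fun g h => ext_vertices rfl fun x => by
        simp [PartialTransf.mul_apply] }
  E := leafIdem
  b := gen (N + 2) .b₂
  c := gen (N + 2) .c
  E_empty := ext_vertices rfl fun x => by simp
  E_mul_E S T := ext_vertices rfl fun x => by
    by_cases h1 : x ∈ S <;> by_cases h2 : x ∈ T <;> simp [PartialTransf.mul_apply, h1, h2]
  τ_mul_E g S := ext_vertices rfl fun x => by
    have : x ∈ S.image g ↔ g⁻¹ x ∈ S := by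
      rw [Finset.mem_image]
      constructor
      · rintro ⟨y, hy, rfl⟩
        simpa using hy
      · exact fun h => ⟨_, h, g.apply_symm_apply x⟩
    by_cases h : g⁻¹ x ∈ S
    · change ((permTransf g) x.succ).bind (leafIdem S) =
        ((leafIdem (S.image g)) x.succ).bind (permTransf g)
      rw [leafIdem_succ, if_pos (this.2 h), permTransf_succ, Option.bind_some, leafIdem_succ,
        if_pos h, Option.bind_none]
    · change ((permTransf g) x.succ).bind (leafIdem S) =
        ((leafIdem (S.image g)) x.succ).bind (permTransf g)
      rw [leafIdem_succ, if_neg (mt this.1 h), permTransf_succ, Option.bind_some, leafIdem_succ,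
        if_neg h]
      rfl
  E_mul_τ S g hg := ext_vertices rfl fun x => by
    by_cases h : x ∈ S
    · simp [PartialTransf.mul_apply, h]
    · have : g⁻¹ x = x := by rw [Equiv.Perm.inv_eq_iff_eq, hg x h]
      change ((leafIdem S) x.succ).bind (permTransf g) = _
      rw [leafIdem_succ, if_neg h, Option.bind_some, permTransf_succ, this]
  b_mul_b := ext_vertices rfl fun x => by simp [PartialTransf.mul_apply]
  b_mul_τ g := ext_vertices rfl fun x => by
    change ((gen (N + 2) .b₂) x.succ).bind (permTransf g) = ((permTransf g) x.succ).bind _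
    simp
  b_mul_E S := ext_vertices rfl fun x => by
    by_cases h : x ∈ S <;> simp [PartialTransf.mul_apply, h]
  c_mul_c := ext_vertices rfl fun x => by
    by_cases h : x = 0 <;> simp [PartialTransf.mul_apply, h]
  c_mul_c_mul_c := ext_vertices rfl fun x => by
    by_cases h : x = 0 <;> simp [PartialTransf.mul_apply, h]
  E_univ_mul_c := ext_vertices rfl fun x => by
    by_cases h : x = 0 <;> simp [PartialTransf.mul_apply, h]
  c_mul_swap_mul_c := by
    have h10 : (1 : Fin (N + 1)) ≠ 0 := by
      rw [Ne, Fin.ext_iff, Fin.val_one', Nat.mod_eq_of_lt (by omega)]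
      simp
    refine ext_vertices ?_ fun x => ?_
    -- The centre goes to leaf 0, then to leaf 1, which is outside the domain of c.
    · change (((gen (N + 2) .c) 0).bind (permTransf _)).bind (gen (N + 2) .c) = none
      rw [gen_c_zero, Option.bind_some, permTransf_succ, Option.bind_some, gen_c_succ,
        Equiv.swap_inv, Equiv.swap_apply_left, if_neg h10]
    · change (((gen (N + 2) .c) x.succ).bind (permTransf _)).bind (gen (N + 2) .c) =
        ((gen (N + 2) .b₂) x.succ).bind fun y => ((gen (N + 2) .c) y).bind (gen (N + 2) .c)
      by_cases h : x = 0 <;> simp [h]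
  b_mul_c_sq := ext_vertices rfl fun x => by
    by_cases h : x = 0 <;> simp [PartialTransf.mul_apply, h]

theorem starModel_compatible (hN : 1 ≤ N) : (starModel hN).Compatible (gen (N + 2)) where
  a₁ := ext_vertices rfl fun x => by
    change some ((finRotate (N + 1))⁻¹⁻¹ x).succ = if x.succ = 0 then some 0 else
      if h : ((x.succ : Fin (N + 2)) : ℕ) + 1 < N + 2 then some ⟨(x.succ : Fin (N + 2)) + 1, h⟩
      else some 1
    rw [if_neg (Fin.succ_ne_zero x), inv_inv]
    have hx := x.2
    -- Leaf x is the vertex x + 1; the last leaf is the vertex n - 1, the only one at which α₁ wraps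
    -- around.
    by_cases h : x = Fin.last N
    · rw [dif_neg (by simp [h]), h, finRotate_last]
      rfl
    · have h' : (x : ℕ) ≠ N := fun h' => h (Fin.ext h')
      rw [dif_pos (by simp; omega)]
      congr 1
      apply Fin.ext
      change ((finRotate (N + 1) x).succ : ℕ) = (x.succ : ℕ) + 1
      rw [Fin.val_succ, coe_finRotate_of_ne_last h, Fin.val_succ]
  a₂ := by
    have v2 : ((2 : Fin (N + 2)) : ℕ) = 2 := Nat.mod_eq_of_lt (show 2 < N + 2 by omega)
    have h2 : Fin.succ (1 : Fin (N + 1)) = 2 := by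
      rw [Fin.ext_iff, v2, Fin.val_succ, Fin.val_one', Nat.mod_eq_of_lt (by omega)]
    refine ext_vertices ?_ fun x => ?_
    · change some 0 = some (Equiv.swap 1 2 0)
      rw [Equiv.swap_apply_of_ne_of_ne]
      · exact Fin.zero_ne_one
      · rw [Ne, Fin.ext_iff, v2]
        simp
    · change some ((Equiv.swap 0 1 : Equiv.Perm (Fin (N + 1)))⁻¹ x).succ =
        some (Equiv.swap 1 2 x.succ)
      rw [Equiv.swap_inv, (Fin.succ_injective (N + 1)).map_swap, h2, Fin.succ_zero_eq_one]
  b₁ := ext_vertices (by rw [gen]; simp; rfl) fun x => by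
    change (if x ∈ ({Fin.last N} : Finset _) then none else some x.succ) =
      if ((x.succ : Fin (N + 2)) : ℕ) + 1 < N + 2 then some x.succ else none
    have hx := x.2
    by_cases h : x = Fin.last N
    · rw [if_pos (by simpa using h), if_neg (by simp [h])]
    · have h' : (x : ℕ) ≠ N := fun h' => h (Fin.ext h')
      rw [if_neg (by simpa using h), if_pos (by simp; omega)]
  b₂ := rfl
  c := rfl

/-- The partial transformation given by a normal form. -/
def evalShape : StarShape N → PartialTransf (Fin (N + 2))
  | .fix S g => ⟨Fin.cases (some 0) fun x => if x ∈ S then none else some (g⁻¹ x).succ⟩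
  | .drop S g => ⟨Fin.cases none fun x => if x ∈ S then none else some (g⁻¹ x).succ⟩
  | .flip g h => ⟨Fin.cases (some (h⁻¹ 0).succ) fun x => if x = g 0 then some 0 else none⟩
  | .out h => ⟨Fin.cases (some (h⁻¹ 0).succ) fun _ => none⟩
  | .into g => ⟨Fin.cases none fun x => if x = g 0 then some 0 else none⟩

theorem nf_starModel (hN : 1 ≤ N) (p : StarShape N) : (starModel hN).nf p = evalShape p := by
  rcases p with ⟨S, g⟩ | ⟨S, g⟩ | ⟨g, h⟩ | h | g
  · refine ext_vertices rfl fun x => ?_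
    change ((leafIdem S) x.succ).bind (permTransf g) = if x ∈ S then none else some (g⁻¹ x).succ
    by_cases hx : x ∈ S <;> simp [hx]
  · refine ext_vertices rfl fun x => ?_
    change (((leafIdem S) x.succ).bind (permTransf g)).bind (gen (N + 2) .b₂) =
      if x ∈ S then none else some (g⁻¹ x).succ
    by_cases hx : x ∈ S <;> simp [hx]
  · refine ext_vertices rfl fun x => ?_
    change (((permTransf g) x.succ).bind (gen (N + 2) .c)).bind (permTransf h) =
      if x = g 0 then some 0 else none
    have hgx : g⁻¹ x = 0 ↔ x = g 0 := by rw [Equiv.Perm.inv_eq_iff_eq]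
    rw [permTransf_succ, Option.bind_some, gen_c_succ]
    simp only [hgx]
    by_cases hx : x = g 0 <;> simp [hx]
  · refine ext_vertices rfl fun x => ?_
    change (((leafIdem Finset.univ) x.succ).bind (gen (N + 2) .c)).bind (permTransf h) = none
    simp
  · refine ext_vertices ?_ fun x => ?_
    · change (((permTransf g) 0).bind (gen (N + 2) .c)).bind (leafIdem Finset.univ) = none
      simp
    · change (((permTransf g) x.succ).bind (gen (N + 2) .c)).bind (leafIdem Finset.univ) =
        if x = g 0 then some 0 else none
      have hgx : g⁻¹ x = 0 ↔ x = g 0 := by rw [Equiv.Perm.inv_eq_iff_eq]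
      rw [permTransf_succ, Option.bind_some, gen_c_succ]
      simp only [hgx]
      by_cases hx : x = g 0 <;> simp [hx]

/-- A normal form is determined by the partial transformation it stands for. -/
theorem nf_eq_of_evalShape_eq {M : Type*} [Monoid M] (D : StarData N M) (p q : StarShape N)
    (h : evalShape p = evalShape q) : D.nf p = D.nf q := by
  have hleaf : ∀ {S T : Finset (Fin (N + 1))} {g k : Equiv.Perm (Fin (N + 1))},
      (∀ x, (if x ∈ S then none else some (g⁻¹ x).succ : Option (Fin (N + 2))) =
        if x ∈ T then none else some (k⁻¹ x).succ) → D.E S * D.τ g = D.E T * D.τ k := by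
    intro S T g k hx
    have hST : S = T := by
      ext x
      have := hx x
      by_cases h1 : x ∈ S <;> by_cases h2 : x ∈ T <;> simp_all
    subst hST
    refine D.E_mul_τ_congr fun x hxS => ?_
    have := hx x
    rw [if_neg hxS, if_neg hxS] at this
    exact Fin.succ_injective _ (Option.some_injective _ this)
  have hin : ∀ {g k : Equiv.Perm (Fin (N + 1))},
      (∀ x, (if x = g 0 then some 0 else none : Option (Fin (N + 2))) =
        if x = k 0 then some 0 else none) → D.τ g * D.c = D.τ k * D.c := by
    intro g k hx
    refine D.τ_mul_c_congr ?_
    by_contra hne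
    have := hx (g 0)
    rw [if_pos rfl, if_neg hne] at this
    cases this
  have hout : ∀ {g k : Equiv.Perm (Fin (N + 1))},
      (some (g⁻¹ 0).succ : Option (Fin (N + 2))) = some (k⁻¹ 0).succ →
        D.c * D.τ g = D.c * D.τ k := fun hx =>
    D.c_mul_τ_congr (Fin.succ_injective _ (Option.some_injective _ hx))
  have h0 : evalShape p 0 = evalShape q 0 := by rw [h]
  have hs : ∀ x : Fin (N + 1), evalShape p x.succ = evalShape q x.succ := fun x => by rw [h]
  rcases p with ⟨S, g⟩ | ⟨S, g⟩ | ⟨g, g'⟩ | g' | g <;>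
    rcases q with ⟨T, k⟩ | ⟨T, k⟩ | ⟨k, k'⟩ | k' | k <;>
    simp only [evalShape, Fin.cases_zero, Fin.cases_succ] at h0 hs
  -- The value at the centre (undefined, the centre, or a leaf) rules out 16 of the 25 pairs of
  -- kinds.
  all_goals try cases h0
  · exact hleaf hs
  · simp only [StarData.nf]; rw [hleaf hs]
  · have := hs (k 0)
    rw [if_pos rfl] at this
    split_ifs at this
    exact absurd (Option.some_injective _ this) (Fin.succ_ne_zero _)
  · simp only [StarData.nf]; rw [hin hs, mul_assoc, mul_assoc, hout h0]
  · have := hs (g 0)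
    rw [if_pos rfl] at this
    cases this
  · have := hs (k 0)
    rw [if_pos rfl] at this
    cases this
  · simp only [StarData.nf]; rw [mul_assoc, mul_assoc, hout h0]
  · have := hs (g 0)
    rw [if_pos rfl] at this
    split_ifs at this
    exact absurd (Option.some_injective _ this).symm (Fin.succ_ne_zero _)
  · simp only [StarData.nf]; rw [hin hs]

end DPS

/-! ### Normal forms under homomorphisms -/

namespace StarData

variable {N : ℕ} {M M' : Type*} [Monoid M] [Monoid M']

theorem E_singleton_eq (D : StarData N M) (i : Fin (N + 1)) : D.E {i} =
    D.τ (Equiv.swap (Fin.last N) i) * D.E {Fin.last N} * D.τ (Equiv.swap (Fin.last N) i) := by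
  rw [D.τ_mul_E_singleton, mul_assoc, ← map_mul, Equiv.swap_mul_self, map_one, mul_one,
    Equiv.swap_apply_left]

/-- Compatible data are determined by the letters: adjacent transpositions are conjugates of (0 1)
by rotations, and every `E {i}` is a conjugate of the idempotent of the last leaf. -/
theorem Compatible.map_nf {D : StarData N M} {D' : StarData N M'} {v : DPS.Letter → M}
    {v' : DPS.Letter → M'} (hD : D.Compatible v) (hD' : D'.Compatible v') (φ : M →* M')
    (hφ : ∀ x, φ (v x) = v' x) (p : StarShape N) : φ (D.nf p) = D'.nf p := by
  have hτ : φ.comp D.τ = D'.τ := by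
    refine MonoidHom.eq_of_eqOn_denseM (Equiv.Perm.mclosure_swap_castSucc_succ N) ?_
    rintro _ ⟨i, rfl⟩
    change φ (D.τ (Equiv.swap _ _)) = D'.τ (Equiv.swap _ _)
    rw [← swap_finRotate_pow_conj N i i.2]
    have h1 : φ.comp D.τ (Equiv.swap 0 1) = D'.τ (Equiv.swap 0 1) := by
      rw [hD'.a₂, ← hφ, ← hD.a₂, MonoidHom.comp_apply]
    have h2 : φ.comp D.τ (finRotate (N + 1))⁻¹ = D'.τ (finRotate (N + 1))⁻¹ := by
      rw [hD'.a₁, ← hφ, ← hD.a₁, MonoidHom.comp_apply]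
    have h3 : finRotate (N + 1) = (finRotate (N + 1))⁻¹ ^ N := by
      rw [inv_pow, eq_comm, inv_eq_iff_mul_eq_one, ← pow_succ, finRotate_pow_self]
    have h4 : φ.comp D.τ (finRotate (N + 1)) = D'.τ (finRotate (N + 1)) := by
      rw [h3, map_pow, h2, map_pow]
    change φ.comp D.τ _ = _
    rw [← inv_pow]
    simp only [map_mul, map_pow, h1, h2, h4]
  have hτ' : ∀ g, φ (D.τ g) = D'.τ g := fun g => DFunLike.congr_fun hτ g
  have hE1 : ∀ i, φ (D.E {i}) = D'.E {i} := by
    intro i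
    rw [D.E_singleton_eq, D'.E_singleton_eq, map_mul, map_mul, hτ', hD.b₁, hφ, hD'.b₁]
  have hE : ∀ S, φ (D.E S) = D'.E S := by
    intro S
    induction S using Finset.induction_on with
    | empty => rw [D.E_empty, D'.E_empty, map_one]
    | insert i S hi ih => rw [Finset.insert_eq, ← D.E_mul_E, ← D'.E_mul_E, map_mul, ih, hE1]
  have hb : φ D.b = D'.b := by rw [hD.b₂, hφ, hD'.b₂]
  have hc : φ D.c = D'.c := by rw [hD.c, hφ, hD'.c]
  rcases p with ⟨S, g⟩ | ⟨S, g⟩ | ⟨g, h⟩ | h | g <;> simp only [nf, map_mul, hτ', hE, hb, hc]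

theorem Compatible.exists_nf_eq {D : StarData N M} {v : DPS.Letter → M} (hD : D.Compatible v)
    (hN : 1 ≤ N) (hv : Submonoid.closure (Set.range v) = ⊤) (x : M) : ∃ p, D.nf p = x := by
  have hx : x ∈ Submonoid.closure (Set.range v) := by rw [hv]; exact Submonoid.mem_top x
  induction hx using Submonoid.closure_induction_right with
  | one => exact ⟨.fix ∅ 1, by simp [nf, D.E_empty]⟩
  | mul_right x _ y hy ih =>
    obtain ⟨p, rfl⟩ := ih
    obtain ⟨l, rfl⟩ := hy
    cases l with
    | a₁ => rw [← hD.a₁]; exact D.nf_mul_τ p _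
    | a₂ => rw [← hD.a₂]; exact D.nf_mul_τ p _
    | b₁ => rw [← hD.b₁]; exact D.nf_mul_E hN p _
    | b₂ => rw [← hD.b₂]; exact D.nf_mul_b hN p
    | c => rw [← hD.c]; exact D.nf_mul_c hN p

end StarData

/-! ### Classification of the partial isometries and the isomorphism -/

namespace DPS

variable {N : ℕ}

theorem dist_starGraph {V : Type*} [DecidableEq V] (r x y : V) :
    (SimpleGraph.starGraph r).dist x y = if x = y then 0 else if x = r ∨ y = r then 1 else 2 := by
  have hconn := SimpleGraph.connected_starGraph r
  split_ifs with h1 h2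
  · rw [h1, SimpleGraph.dist_self]
  · rw [SimpleGraph.dist_eq_one_iff_adj, SimpleGraph.starGraph_adj]
    exact ⟨h1, h2⟩
  · push Not at h2
    have h3 : (SimpleGraph.starGraph r).dist x y ≤ 2 := by
      have hx : (SimpleGraph.starGraph r).Adj x r := SimpleGraph.starGraph_center_adj' h2.1.symm
      have hy : (SimpleGraph.starGraph r).Adj r y := SimpleGraph.starGraph_center_adj h2.2.symm
      exact SimpleGraph.dist_le (SimpleGraph.Walk.cons hx (SimpleGraph.Walk.cons hy .nil))
    have h4 : (SimpleGraph.starGraph r).dist x y ≠ 0 := by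
      rw [Ne, hconn.dist_eq_zero_iff]
      exact h1
    have h5 : (SimpleGraph.starGraph r).dist x y ≠ 1 := by
      rw [Ne, SimpleGraph.dist_eq_one_iff_adj, SimpleGraph.starGraph_adj]
      tauto
    omega

theorem mem_iff (f : PartialTransf (Fin (N + 2))) : f ∈ DPS (N + 2) ↔
    ∀ x y x' y', f x = some x' → f y = some y' →
      (if x' = y' then 0 else if x' = 0 ∨ y' = 0 then 1 else 2) =
        if x = y then 0 else if x = 0 ∨ y = 0 then 1 else 2 := by
  simp only [← dist_starGraph]
  exact Iff.rfl

theorem evalShape_mem (p : StarShape N) : evalShape p ∈ DPS (N + 2) := by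
  have h0 : ∀ y : Fin (N + 1), ¬ (0 = y.succ) := fun y => (Fin.succ_ne_zero y).symm
  rw [mem_iff]
  intro x y x' y'
  rcases p with ⟨S, g⟩ | ⟨S, g⟩ | ⟨g, h⟩ | h | g <;>
    cases x using Fin.cases with
    | zero => cases y using Fin.cases <;> simp only [evalShape, Fin.cases_zero, Fin.cases_succ] <;>
        grind
    | succ x =>
      cases y using Fin.cases <;> simp only [evalShape, Fin.cases_zero, Fin.cases_succ] <;>
        grind [Equiv.injective]

/-- Preserving distances forces injectivity, so f is a partial injection from leaves to leaves; on a
finite set it extends to a permutation. The inverse reflects the action on the right. -/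
theorem exists_perm_of_leaves {f : PartialTransf (Fin (N + 2))} (hf : f ∈ DPS (N + 2))
    (h0 : ∀ x : Fin (N + 1), f x.succ ≠ some 0) :
    ∃ (S : Finset (Fin (N + 1))) (g : Equiv.Perm (Fin (N + 1))),
      ∀ x, f x.succ = if x ∈ S then none else some (g⁻¹ x).succ := by
  classical
  rw [mem_iff] at hf
  -- Outside the domain y is arbitrary; a total function is needed only in order to choose.
  have h1 : ∀ x : Fin (N + 1), ∃ y, f x.succ ≠ none → f x.succ = some (Fin.succ y) := by
    intro x
    cases hx : f x.succ with
    | none => exact ⟨0, fun h => absurd rfl h⟩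
    | some v =>
      cases v using Fin.cases with
      | zero => exact absurd hx (h0 x)
      | succ y => exact ⟨y, fun _ => rfl⟩
  choose k hk using h1
  obtain ⟨g, hg⟩ := Set.MapsTo.exists_equiv_extend_of_card_eq (α := Fin (N + 1))
    (t := (Finset.univ : Finset (Fin (N + 1)))) (by simp) (s := {x | f x.succ ≠ none}) (f := k)
    (fun x _ => by simp) (by
      intro x hx y hy hxy
      have h := hf x.succ y.succ _ _ (hk x hx) (hk y hy)
      rw [if_pos (by rw [hxy])] at h
      by_contra hne
      rw [if_neg (fun h => hne (Fin.succ_injective _ h))] at h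
      split_ifs at h)
  refine ⟨Finset.univ.filter fun x => f x.succ = none,
    (g.trans (Equiv.subtypeUnivEquiv fun x => Finset.mem_univ x))⁻¹, fun x => ?_⟩
  by_cases hx : f x.succ = none
  · rw [if_pos (by simpa using hx), hx]
  · rw [if_neg (by simpa using hx), hk x hx, inv_inv, ← hg x hx]
    rfl

/-- If a leaf goes to the centre, no other leaf is in the domain, since two leaves are at distance 2
and nothing is that far from the centre. If the centre goes to a leaf, every leaf in the domain must
go to a neighbour of that leaf, that is, to the centre. Otherwise leaves go to leaves. -/
theorem exists_evalShape_eq {f : PartialTransf (Fin (N + 2))} (hf : f ∈ DPS (N + 2)) :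
    ∃ p, evalShape p = f := by
  have hf' := (mem_iff f).1 hf
  have hin : ∀ i : Fin (N + 1), f i.succ = some 0 → (∀ x, x ≠ i → f x.succ = none) →
      ∀ x : Fin (N + 1), (if x = Equiv.swap 0 i 0 then some 0 else none) = f x.succ := by
    intro i hi h x
    rw [Equiv.swap_apply_left]
    split_ifs with hx
    · rw [hx, hi]
    · rw [h x hx]
  have huniq : ∀ i : Fin (N + 1), f i.succ = some 0 → ∀ x, x ≠ i → f x.succ = none := by
    intro i hi x hx
    cases hfx : f x.succ with
    | none => rfl
    | some v =>
      have h := hf' _ _ _ _ hi hfx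
      have hne : i.succ ≠ x.succ := fun h => hx (Fin.succ_injective _ h).symm
      rw [if_neg hne, if_neg (not_or.2 ⟨Fin.succ_ne_zero i, Fin.succ_ne_zero x⟩)] at h
      split_ifs at h <;> simp_all
  cases h0 : f 0 with
  | none =>
    by_cases h : ∃ i : Fin (N + 1), f i.succ = some 0
    · obtain ⟨i, hi⟩ := h
      exact ⟨.into (Equiv.swap 0 i), ext_vertices h0.symm (hin i hi (huniq i hi))⟩
    · push Not at h
      obtain ⟨S, g, hg⟩ := exists_perm_of_leaves hf h
      exact ⟨.drop S g, ext_vertices h0.symm fun x => (hg x).symm⟩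
  | some v =>
    cases v using Fin.cases with
    | zero =>
      have h : ∀ x : Fin (N + 1), f x.succ ≠ some 0 := by
        intro x hx
        have h := hf' _ _ _ _ h0 hx
        rw [if_pos rfl, if_neg (Fin.succ_ne_zero x).symm, if_pos (Or.inl rfl)] at h
        omega
      obtain ⟨S, g, hg⟩ := exists_perm_of_leaves hf h
      exact ⟨.fix S g, ext_vertices h0.symm fun x => (hg x).symm⟩
    | succ k =>
      have hk : (some (((Equiv.swap 0 k)⁻¹ 0 : Fin (N + 1))).succ : Option (Fin (N + 2))) =
          f 0 := by
        rw [Equiv.swap_inv, Equiv.swap_apply_left, h0]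
      by_cases h : ∃ i : Fin (N + 1), f i.succ = some 0
      · obtain ⟨i, hi⟩ := h
        exact ⟨.flip (Equiv.swap 0 i) (Equiv.swap 0 k), ext_vertices hk (hin i hi (huniq i hi))⟩
      · push Not at h
        refine ⟨.out (Equiv.swap 0 k), ext_vertices hk fun x => ?_⟩
        change none = f x.succ
        cases hfx : f x.succ with
        | none => rfl
        | some v =>
          have hd := hf' _ _ _ _ h0 hfx
          have hv : v ≠ 0 := by
            rintro rfl
            exact h x hfx
          rw [if_neg (Fin.succ_ne_zero x).symm, if_pos (Or.inl rfl)] at hd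
          split_ifs at hd with h1 h2
          · rcases h2 with h2 | h2
            · exact absurd h2 (Fin.succ_ne_zero k)
            · exact absurd h2 hv
          · omega

theorem exists_mulEquiv (hN : 2 ≤ N) :
    Submonoid.closure (Set.range (gen (N + 2))) = DPS (N + 2) ∧
      ∃ e : Presented (N + 2) ≃* DPS (N + 2),
        ∀ x : Letter, (e (letterClass (N + 2) x) : PartialTransf (Fin (N + 2))) =
          gen (N + 2) x := by
  have hD₀ := starModel_compatible (N := N) (by omega)
  obtain ⟨D, hD⟩ := exists_starData_of_relations (N := N) hN (letterClass (N + 2)) (by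
    have h : FreeMonoid.lift (letterClass (N + 2)) = PresentedMonoid.mk _ :=
      FreeMonoid.hom_eq fun x => rfl
    rintro ⟨u, w⟩ huw
    rw [h]
    exact PresentedMonoid.mk_eq_mk_of_rel huw)
  let φ : Presented (N + 2) →* PartialTransf (Fin (N + 2)) :=
    PresentedMonoid.lift (gen (N + 2)) fun u w huw => hD₀.satisfies hN (u, w) huw
  have hφ : ∀ x, φ (letterClass (N + 2) x) = gen (N + 2) x := fun x => rfl
  have hφnf : ∀ p, φ (D.nf p) = evalShape p := fun p => by
    rw [hD.map_nf hD₀ φ hφ, nf_starModel]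
  have hnf := hD.exists_nf_eq (by omega) (PresentedMonoid.closure_range_of _)
  -- Every element is a normal form, and equal images mean equal `evalShape`, hence equal normal
  -- forms.
  have hinj : Function.Injective φ := by
    intro x y hxy
    obtain ⟨p, rfl⟩ := hnf x
    obtain ⟨q, rfl⟩ := hnf y
    rw [hφnf, hφnf] at hxy
    exact nf_eq_of_evalShape_eq D p q hxy
  have hrange : MonoidHom.mrange φ = DPS (N + 2) := by
    ext f
    constructor
    · rintro ⟨x, rfl⟩
      obtain ⟨p, rfl⟩ := hnf x
      rw [hφnf]
      exact evalShape_mem p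
    · intro hf
      obtain ⟨p, rfl⟩ := exists_evalShape_eq hf
      exact ⟨D.nf p, hφnf p⟩
  have hmem : ∀ x, φ x ∈ DPS (N + 2) := fun x => hrange ▸ ⟨x, rfl⟩
  refine ⟨?_, MulEquiv.ofBijective (φ.codRestrict (DPS (N + 2)) hmem) ⟨?_, ?_⟩, fun x => rfl⟩
  rotate_left
  · exact fun x y hxy => hinj (congrArg Subtype.val hxy)
  · rintro ⟨f, hf⟩
    obtain ⟨x, rfl⟩ := hrange.ge hf
    exact ⟨x, rfl⟩
  rw [← hrange, MonoidHom.mrange_eq_map, ← PresentedMonoid.closure_range_of, MonoidHom.map_mclosure,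
    ← Set.range_comp]
  rfl

/-- The values at 0 and 2 suffice: β₂ is undefined at 0, γ moves 0, and α₁, α₂, β₁ send 2 to 3, 1,
2. -/
theorem gen_injective (N : ℕ) : Function.Injective (gen (N + 4)) := by
  intro x y h
  have v2 : ((2 : Fin (N + 4)) : ℕ) = 2 := Nat.mod_eq_of_lt (show 2 < N + 4 by omega)
  have n1 : (1 : Fin (N + 4)) ≠ 0 := Fin.zero_ne_one.symm
  have n2 : (2 : Fin (N + 4)) ≠ 0 := by rw [Ne, Fin.ext_iff, v2]; simp
  have n12 : (2 : Fin (N + 4)) ≠ 1 := by rw [Ne, Fin.ext_iff, v2]; simp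
  have e0 : gen (N + 4) .a₁ 0 = some 0 := rfl
  have e2 : gen (N + 4) .a₁ 2 = some 3 := by
    change (if (2 : Fin (N + 4)) = 0 then some 0 else
      if h : ((2 : Fin (N + 4)) : ℕ) + 1 < N + 4 then
        some (⟨((2 : Fin (N + 4)) : ℕ) + 1, h⟩ : Fin (N + 4)) else some 1) = some 3
    rw [if_neg n2, dif_pos (by omega)]
    rfl
  have f0 : gen (N + 4) .a₂ 0 = some 0 :=
    congrArg some (Equiv.swap_apply_of_ne_of_ne n1.symm n2.symm)
  have f2 : gen (N + 4) .a₂ 2 = some 1 := congrArg some (Equiv.swap_apply_right _ _)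
  have g0 : gen (N + 4) .b₁ 0 = some 0 := by simp [gen]
  have g2 : gen (N + 4) .b₁ 2 = some 2 :=
    if_pos (c := ((2 : Fin (N + 4)) : ℕ) + 1 < N + 4) (e := none) (by omega)
  have k0 : gen (N + 4) .b₂ 0 = none := rfl
  have l0 : gen (N + 4) .c 0 = some 1 := rfl
  have n3 : (3 : Fin (N + 4)) ≠ 1 ∧ (3 : Fin (N + 4)) ≠ 2 := by
    have v3 : ((3 : Fin (N + 4)) : ℕ) = 3 := Nat.mod_eq_of_lt (show 3 < N + 4 by omega)
    constructor <;> rw [Ne, Fin.ext_iff, v3]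
    · simp
    · rw [v2]; omega
  have h0 : gen (N + 4) x 0 = gen (N + 4) y 0 := by rw [h]
  have h2 : gen (N + 4) x 2 = gen (N + 4) y 2 := by rw [h]
  cases x <;> cases y <;> simp_all

theorem card_letter : Nat.card Letter = 5 := by
  let e : Letter ≃ Fin 5 :=
    { toFun := fun | .a₁ => 0 | .a₂ => 1 | .b₁ => 2 | .b₂ => 3 | .c => 4
      invFun := fun | 0 => .a₁ | 1 => .a₂ | 2 => .b₁ | 3 => .b₂ | 4 => .c
      left_inv := fun x => by cases x <;> rfl
      right_inv := fun x => by fin_cases x <;> rfl }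
  rw [Nat.card_congr e, Nat.card_fin]

end DPS

/-! ### Counting the relations -/

namespace DPS

/-- Kronecker's delta on letters. -/
def mark : Letter → Letter → ℕ
  | .a₁, .a₁ | .a₂, .a₂ | .b₁, .b₁ | .b₂, .b₂ | .c, .c => 1
  | _, _ => 0

/-- The number of occurrences of a letter in a word. -/
def occ (l : Letter) (u : FreeMonoid Letter) : ℕ :=
  (FreeMonoid.lift (fun l' => Multiplicative.ofAdd (mark l l')) u).toAdd

@[simp] theorem occ_of (l l' : Letter) : occ l (FreeMonoid.of l') = mark l l' := by simp [occ]

@[simp] theorem occ_mul (l : Letter) (u v : FreeMonoid Letter) :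
    occ l (u * v) = occ l u + occ l v := by
  simp [occ]

@[simp] theorem occ_pow (l : Letter) (u : FreeMonoid Letter) (k : ℕ) :
    occ l (u ^ k) = k * occ l u := by
  simp [occ]

/-- The numbers of occurrences of all letters in the first word of a pair. -/
def occs (p : FreeMonoid Letter × FreeMonoid Letter) : ℕ × ℕ × ℕ × ℕ × ℕ :=
  (occ .a₁ p.1, occ .a₂ p.1, occ .b₁ p.1, occ .b₂ p.1, occ .c p.1)

theorem notMem_of_occs {p : FreeMonoid Letter × FreeMonoid Letter}
    {S : Set (FreeMonoid Letter × FreeMonoid Letter)} (h : occs p ∉ occs '' S) : p ∉ S :=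
  fun hp => h (Set.mem_image_of_mem occs hp)

/-- Tags increase along the union, so each set is disjoint from the union of those before it. -/
theorem ncard_union_of_tag {α : Type*} (t : α → ℕ) {A₁ A₂ A₃ A₄ A₅ A₆ A₇ : Set α}
    (f₁ : A₁.Finite) (f₂ : A₂.Finite) (f₃ : A₃.Finite) (f₄ : A₄.Finite) (f₅ : A₅.Finite)
    (f₆ : A₆.Finite) (f₇ : A₇.Finite) (h₁ : ∀ p ∈ A₁, t p = 1) (h₂ : ∀ p ∈ A₂, t p = 2)
    (h₃ : ∀ p ∈ A₃, t p = 3) (h₄ : ∀ p ∈ A₄, t p = 4) (h₅ : ∀ p ∈ A₅, t p = 5)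
    (h₆ : ∀ p ∈ A₆, t p = 6) (h₇ : ∀ p ∈ A₇, t p = 7) :
    (A₁ ∪ A₂ ∪ A₃ ∪ A₄ ∪ A₅ ∪ A₆ ∪ A₇).ncard =
      A₁.ncard + A₂.ncard + A₃.ncard + A₄.ncard + A₅.ncard + A₆.ncard + A₇.ncard := by
  have hd : ∀ {A B : Set α} (k : ℕ), (∀ p ∈ A, t p < k) → (∀ p ∈ B, t p = k) → Disjoint A B :=
    fun k hA hB => Set.disjoint_left.2 fun p hp hp' => (hA p hp).ne (hB p hp')
  rw [Set.ncard_union_eq (hd 7 (by grind) h₇) (by simp [*]) f₇,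
    Set.ncard_union_eq (hd 6 (by grind) h₆) (by simp [*]) f₆,
    Set.ncard_union_eq (hd 5 (by grind) h₅) (by simp [*]) f₅,
    Set.ncard_union_eq (hd 4 (by grind) h₄) (by simp [*]) f₄,
    Set.ncard_union_eq (hd 3 (by grind) h₃) (by simp [*]) f₃,
    Set.ncard_union_eq (hd 2 (by grind) h₂) f₁ f₂]

/-- A number, depending only on the numbers of occurrences of the letters, that tells apart the
seven sets of which the set of relations is the union. -/
def tag (N : ℕ) : ℕ × ℕ × ℕ × ℕ × ℕ → ℕ := fun ⟨x₁, x₂, y₁, y₂, z⟩ =>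
  if y₁ + y₂ + z = 0 then if x₁ = 2 * N + 2 ∧ x₂ = 4 then 2 else 1
  else if y₁ = 0 ∧ y₂ = 0 ∧ z = 1 ∧ x₂ = 1 then 4
  else if y₁ = 1 ∧ y₂ = 0 ∧ z = 1 then if x₁ = 1 then 5 else 6
  else if (1 ≤ y₂ ∧ 1 ≤ z) ∨ (x₁ + 1 = y₁ ∧ x₂ = 0 ∧ y₂ = 0 ∧ z = 0 ∧ 2 ≤ y₁) then 7
  else 3

/-- All these words have the same letter counts, so the words are made to act on ℕ by noncommuting
maps instead. -/
theorem injOn_moore (N : ℕ) : Set.InjOn (fun j : ℕ =>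
    (((a₂ * a₁ ^ (N + 1 - j) * a₂ * a₁ ^ j) ^ 2, 1) : FreeMonoid Letter × FreeMonoid Letter))
      (Set.Icc 2 (N - 1)) := by
  rintro i ⟨hi, hi'⟩ j ⟨hj, hj'⟩ hij
  let φ : FreeMonoid Letter →* Function.End ℕ := FreeMonoid.lift fun
    | .a₁ => (fun x => x + 1 : ℕ → ℕ)
    | .a₂ => (fun x => 2 * x : ℕ → ℕ)
    | _ => 1
  have h₂ : ∀ x, φ a₂ x = 2 * x := fun x => rfl
  have h₁ : ∀ k x, φ (a₁ ^ k) x = x + k := by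
    intro k
    induction k with
    | zero => exact fun x => rfl
    | succ k ih =>
      intro x
      rw [pow_succ', map_mul]
      change φ (a₁ ^ k) x + 1 = _
      rw [ih, add_assoc]
  have hmul : ∀ u v x, φ (u * v) x = φ u (φ v x) := fun u v x => by rw [map_mul]; rfl
  -- The word with parameter j, its rightmost letter acting first, takes 0 to 10 (N + 1 + j).
  have h := congrFun (congrArg φ (congrArg Prod.fst hij)) 0
  simp only [pow_two, hmul, h₁, h₂] at h
  omega

/-- The seven blocks have 4, N - 2, 12, N - 1, 1, N - 2 and 3 elements. Distinct relations already
differ in their first words. -/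
theorem ncard_relations {N : ℕ} (hN : 2 ≤ N) : (relations (N + 2)).ncard = 3 * (N + 2) + 9 := by
  have c₁ : N + 2 - 1 = N + 1 := rfl
  have c₃ : N + 2 - 3 = N - 1 := rfl
  have c₄ : N + 2 - 4 = N - 2 := rfl
  simp only [relations, c₁, c₃, c₄, Nat.add_sub_cancel]
  have hfin : ∀ (f : ℕ → FreeMonoid Letter × FreeMonoid Letter) (i j : ℕ),
      (f '' Set.Icc i j).Finite := fun f i j => (Set.finite_Icc i j).image f
  have hcard : ∀ i j, (Set.Icc i j).ncard = j + 1 - i := fun i j => by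
    rw [← Finset.coe_Icc, Set.ncard_coe_finset, Nat.card_Icc]
  rw [ncard_union_of_tag fun p => tag N (occs p), (injOn_moore N).ncard_image,
    Set.InjOn.ncard_image, Set.InjOn.ncard_image, hcard, hcard, Set.ncard_singleton]
  · rw [Set.ncard_insert_of_notMem, Set.ncard_insert_of_notMem, Set.ncard_insert_of_notMem,
      Set.ncard_singleton]
    rw [Set.ncard_insert_of_notMem, Set.ncard_insert_of_notMem, Set.ncard_insert_of_notMem,
      Set.ncard_insert_of_notMem, Set.ncard_insert_of_notMem, Set.ncard_insert_of_notMem,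
      Set.ncard_insert_of_notMem, Set.ncard_insert_of_notMem, Set.ncard_insert_of_notMem,
      Set.ncard_insert_of_notMem, Set.ncard_insert_of_notMem, Set.ncard_singleton]
    rw [Set.ncard_insert_of_notMem, Set.ncard_insert_of_notMem, Set.ncard_singleton]
    · omega
    all_goals
      apply notMem_of_occs
      simp [occs, mark, Set.image_insert_eq]
      try omega
  -- In the two families that involve c, the parameter is the number of letters a₁ in the first
  -- word.
  · intro i hi j hj hij
    have := congrArg (fun p => occ .a₁ p.1) hij
    simpa [mark] using this
  · intro i hi j hj hij
    have := congrArg (fun p => occ .a₁ p.1) hij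
    simpa [mark] using this
  all_goals first
    | exact Set.toFinite _
    | simp only [Set.mem_insert_iff, or_imp, forall_and, forall_eq, Set.forall_mem_image,
        Set.mem_singleton_iff, Set.mem_Icc, occs, occ_mul, occ_pow, occ_of, mark, mul_zero, mul_one,
        zero_add, add_zero, Nat.reduceAdd, Nat.reduceMul, tag]
  · refine ⟨?_, ?_, ?_, ?_⟩ <;> grind
  · intro j hj
    grind
  · refine ⟨?_, ?_, ?_, ?_, ?_, ?_, ?_, ?_, ?_, ?_, ?_, ?_⟩ <;> grind
  · intro j hj
    grind
  · grind
  · intro j hj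
    grind
  · refine ⟨?_, ?_, ?_⟩ <;> grind

end DPS

theorem mainTheorem1 (n : ℕ) [NeZero n] (hn : 4 ≤ n) :
    Nat.card DPS.Letter = 5 ∧
    (DPS.relations n).ncard = 3 * n + 9 ∧
    Function.Injective (DPS.gen n) ∧
    Submonoid.closure (Set.range (DPS.gen n)) = DPS n ∧
    ∃ e : DPS.Presented n ≃* DPS n,
      ∀ x : DPS.Letter, (e (DPS.letterClass n x) : PartialTransf (Fin n)) = DPS.gen n x := by
  obtain ⟨N, rfl⟩ := Nat.exists_eq_add_of_le' hn
  exact ⟨DPS.card_letter, DPS.ncard_relations (N := N + 2) (by omega), DPS.gen_injective N,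
    DPS.exists_mulEquiv (N := N + 2) (by omega)⟩
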